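/- In the Maker--Breaker domination game on a finite graph $G$, Dominator and Staller alternately choose a vertex that has not been played so far. Dominator wins if the vertices he has played form a dominating set of $G$; Staller wins if she has played all vertices of the closed neighborhood $N[v]$ of some vertex $v$. In the D-game Dominator moves first, in the S-game Staller moves first. Let $\gamma_{\rm SMB}(G)$ (respectively $\gamma'_{\rm SMB}(G)$) be the smallest integer $m$ such that Staller can win the D-game (respectively the S-game) within at most $m$ of her own moves, whatever Dominator plays, and $\infty$ if Staller has no winning strategy in that game. For integers $n\ge 3$ and $k\ge 1$, the tadpole graph $T(n,k)$ is obtained from an $n$-cycle and a vertex-disjoint path on $k$ vertices by adding one edge between a vertex of the cycle and an end of the path. Put $$\sigma(n)=\frac{2^{\lceil \log_2 n\rceil}-n}{2}+1 .$$ **Theorem.** For all integers $n\ge 3$ and $k\ge 1$, Dominator has a winning strategy in the D-game on $T(n,k)$, and $\gamma_{\rm SMB}(T(n,k))=\infty$. Moreover, $$\gamma'_{\rm SMB}(T(n,k))=\begin{cases}\lceil \log_2(n+k+\sigma(n))\rceil & \text{if $n$ is even and $k$ is odd},\\ \infty & \text{otherwise.}\end{cases}$$ -/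

import Mathlib

/-- In a two-person game seen from the point of view of one of the players: who moves next. -/
inductive Turn : Type
  | self
  | opponent

/-- The game in which two players alternately choose a vertex that has not been played so far, seen
from the point of view of one player, who wants to claim (play all vertices of) a member of `E`.
`WinsWithin E t m P Q` says: if the player has played exactly the vertices in `P`, the opponent has
played exactly those in `Q`, and the turn is `t`, then the player can make sure, against every play
of the opponent, to have claimed a member of `E` after at most `m` further moves of her own.

* `claimed`: a member of `E` has already been claimed;
* `move`: the player chooses an unplayed vertex `v`, and this uses one of her moves;
* `reply`: it is the opponent's turn, the game is not over (some vertex is unplayed), and the player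
  wins whichever unplayed vertex `w` the opponent chooses. -/
inductive WinsWithin {V : Type*} (E : Set (Set V)) : Turn → ℕ → Set V → Set V → Prop
  | claimed {t : Turn} {m : ℕ} {P Q : Set V} (e : Set V) (he : e ∈ E) (heP : e ⊆ P) :
      WinsWithin E t m P Q
  | move {m : ℕ} {P Q : Set V} (v : V) (hvP : v ∉ P) (hvQ : v ∉ Q)
      (h : WinsWithin E Turn.opponent m (insert v P) Q) :
      WinsWithin E Turn.self (m + 1) P Q
  | reply {m : ℕ} {P Q : Set V} (hfree : ∃ w : V, w ∉ P ∧ w ∉ Q)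
      (h : ∀ w : V, w ∉ P → w ∉ Q → WinsWithin E Turn.self m P (insert w Q)) :
      WinsWithin E Turn.opponent m P Q

/-- The winning number: the least number of her own moves within which the player can always claim a
member of `E`, when the first turn is `t`; it is `⊤` if she has no winning strategy. -/
noncomputable def winningNumber {V : Type*} (E : Set (Set V)) (t : Turn) : ℕ∞ :=
  sInf {x : ℕ∞ | ∃ m : ℕ, x = (m : ℕ∞) ∧ WinsWithin E t m ∅ ∅}

/-- The closed neighborhood `N[v]`. -/
def closedNbhd {V : Type*} (G : SimpleGraph V) (v : V) : Set V :=
  insert v (G.neighborSet v)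

/-- The winning sets of Staller: the closed neighborhoods of the vertices. -/
def closedNbhdHypergraph {V : Type*} (G : SimpleGraph V) : Set (Set V) :=
  Set.range (closedNbhd G)

/-- The winning sets of Dominator: the dominating sets `D`, those with `N[D] = V`. -/
def dominatingSets {V : Type*} (G : SimpleGraph V) : Set (Set V) :=
  {D : Set V | ⋃ v ∈ D, closedNbhd G v = Set.univ}

/-- Dominator has a winning strategy in the D-game (where he moves first). -/
def DominatorWinsDGame {V : Type*} (G : SimpleGraph V) : Prop :=
  ∃ m : ℕ, WinsWithin (dominatingSets G) Turn.self m ∅ ∅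

/-- The SMBD-number `γ_SMB(G)`: the number of moves that Staller needs to win the D-game. -/
noncomputable def gammaSMB {V : Type*} (G : SimpleGraph V) : ℕ∞ :=
  winningNumber (closedNbhdHypergraph G) Turn.opponent

/-- The number `γ'_SMB(G)`: the number of moves that Staller needs to win the S-game. -/
noncomputable def gammaSMB' {V : Type*} (G : SimpleGraph V) : ℕ∞ :=
  winningNumber (closedNbhdHypergraph G) Turn.self

/-- The tadpole graph `T(n,k)`: the disjoint union of an `n`-cycle and a path on `k` vertices,
together with one edge between a vertex of the cycle and an end of the path. -/
def tadpoleGraph (n k : ℕ) (hn : 3 ≤ n) (hk : 1 ≤ k) : SimpleGraph (Fin n ⊕ Fin k) :=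
  SimpleGraph.sum (SimpleGraph.cycleGraph n) (SimpleGraph.pathGraph k) ⊔
    SimpleGraph.edge (Sum.inl ⟨0, by omega⟩) (Sum.inr ⟨0, by omega⟩)

/-- `σ(n) = (2 ^ ⌈log₂ n⌉ - n) / 2 + 1`. -/
noncomputable def tadpoleSigma (n : ℕ) : ℝ :=
  ((2 : ℝ) ^ ⌈Real.logb 2 (n : ℝ)⌉₊ - (n : ℝ)) / 2 + 1

/-! Number the tadpole along a Hamiltonian path: the tail `-k, …, -1`, then the cycle `0, …, n - 1`;
only the edge between `0` and `n - 1` is extra. If `n + k` is even, matching consecutive vertices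
puts a pair into every closed neighborhood, and Dominator answers in pairs. If `n + k` is odd, this
works after he takes the end of the tail. That settles the D-game, and the S-game for even `n + k`.

Let `n + k` be odd. A Staller move with an even number of vertices on either side is harmless, since
the rest can be paired (`Strip.reply_of_even`). A move with odd numbers on both sides cuts off two
odd pieces; Dominator spoils one and play continues on the other. By repeated halving, an odd path
on `N` vertices takes `m` moves with `m` least such that `N < 2 ^ m`.

If `n` is odd, traversing the cycle backwards changes the parity of the cycle positions, so every
cycle move is harmless in one of the two directions. If `n` is even, put `L = ⌈log₂ n⌉`; `m` moves
suffice exactly when `n + 2k + 2 ^ L + 2 ≤ 2 * 2 ^ m`, which is `n + k + σ(n) ≤ 2 ^ m`. Staller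
shortens a long tail, or plays the vertex `0`, or, on a cycle that is long for the number of moves,
plays about opposite to `0`. Dominator keeps a piece that is too large. See
`FreeSeq.tadpole_winsWithin` and `Strip.tadpole_not_winsWithin`. -/

/-! ### Pairing strategies -/

section Breaker

variable {V : Type*} {E : Set (Set V)} {P Q : Set V} {R : V → V → Prop} {v : ℤ → V} {a b : ℤ}

/-- `R` matches up unplayed vertices into disjoint pairs. -/
structure IsPairing (P Q : Set V) (R : V → V → Prop) : Prop where
  disj : ∀ x, x ∈ P → x ∉ Q
  symm : ∀ x y, R x y → R y x
  ne : ∀ x y, R x y → x ≠ y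
  func : ∀ x y z, R x y → R x z → y = z
  notMem_left : ∀ x y, R x y → x ∉ P
  notMem_right : ∀ x y, R x y → x ∉ Q

/-- The winning set `e` is hit by the opponent's set `Q` or contains a pair of `R`. -/
def Blocked (Q : Set V) (R : V → V → Prop) (e : Set V) : Prop :=
  (∃ q ∈ Q, q ∈ e) ∨ ∃ x y, R x y ∧ x ∈ e ∧ y ∈ e

/-- The pairing `R` without the pairs that contain `w`. -/
def eraseVertex (R : V → V → Prop) (w : V) (x y : V) : Prop :=
  R x y ∧ x ≠ w ∧ y ≠ w

theorem IsPairing.erase (h : IsPairing P Q R) (w : V) : IsPairing P Q (eraseVertex R w) where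
  disj := h.disj
  symm x y hxy := ⟨h.symm x y hxy.1, hxy.2.2, hxy.2.1⟩
  ne x y hxy := h.ne x y hxy.1
  func x y z hxy hxz := h.func x y z hxy.1 hxz.1
  notMem_left x y hxy := h.notMem_left x y hxy.1
  notMem_right x y hxy := h.notMem_right x y hxy.1

theorem IsPairing.insert_left (h : IsPairing P Q R) {w : V} (hw : w ∉ Q) (hR : ∀ y, ¬ R w y) :
    IsPairing (insert w P) Q R where
  disj := by
    rintro x (rfl | hx)
    · exact hw
    · exact h.disj x hx
  symm := h.symm
  ne := h.ne
  func := h.func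
  notMem_left := by
    rintro x y hxy (rfl | hx)
    · exact hR y hxy
    · exact h.notMem_left x y hxy hx
  notMem_right := h.notMem_right

theorem IsPairing.insert_right (h : IsPairing P Q R) {w : V} (hw : w ∉ P) (hR : ∀ y, ¬ R w y) :
    IsPairing P (insert w Q) R where
  disj := by
    rintro x hx (rfl | hx')
    · exact hw hx
    · exact h.disj x hx hx'
  symm := h.symm
  ne := h.ne
  func := h.func
  notMem_left := h.notMem_left
  notMem_right := by
    rintro x y hxy (rfl | hx)
    · exact hR y hxy
    · exact h.notMem_right x y hxy hx

theorem eraseVertex_self (R : V → V → Prop) (w y : V) : ¬ eraseVertex R w w y := fun h => h.2.1 rfl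

theorem Blocked.mono {Q' : Set V} {R' : V → V → Prop} {e : Set V} (h : Blocked Q R e)
    (hQ : Q ⊆ Q') (hR : ∀ x y, R x y → R' x y) : Blocked Q' R' e := by
  rcases h with ⟨q, hq, hqe⟩ | ⟨x, y, hxy, hx, hy⟩
  · exact Or.inl ⟨q, hQ hq, hqe⟩
  · exact Or.inr ⟨x, y, hR x y hxy, hx, hy⟩

/-- Erasing the pair at `w` costs nothing: a set that contains this pair contains `w`, which the
opponent now owns. -/
theorem Blocked.insert_erase {e : Set V} {w : V} (h : Blocked Q R e ∨ w ∈ e) :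
    Blocked (insert w Q) (eraseVertex R w) e := by
  rcases h with (⟨q, hq, hqe⟩ | ⟨x, y, hxy, hx, hy⟩) | hw
  · exact Or.inl ⟨q, Or.inr hq, hqe⟩
  · by_cases hxw : x = w
    · exact Or.inl ⟨w, Or.inl rfl, hxw ▸ hx⟩
    by_cases hyw : y = w
    · exact Or.inl ⟨w, Or.inl rfl, hyw ▸ hy⟩
    exact Or.inr ⟨x, y, ⟨hxy, hxw, hyw⟩, hx, hy⟩
  · exact Or.inl ⟨w, Or.inl rfl, hw⟩

theorem Blocked.not_subset {e : Set V} (hR : IsPairing P Q R) (h : Blocked Q R e) (w : V)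
    (hw : w ∉ Q) : ¬ e ⊆ insert w P := by
  intro he
  rcases h with ⟨q, hq, hqe⟩ | ⟨x, y, hxy, hx, hy⟩
  · rcases he hqe with rfl | hqP
    · exact hw hq
    · exact hR.disj q hqP hq
  · have h1 := (he hx).resolve_right (hR.notMem_left x y hxy)
    have h2 := (he hy).resolve_right (hR.notMem_left y x (hR.symm x y hxy))
    exact hR.ne x y hxy (h1.trans h2.symm)

/-- If the opponent has a pairing that blocks all winning sets, the player cannot win. -/
theorem IsPairing.not_winsWithin (hR : IsPairing P Q R) (hE : ∀ e ∈ E, Blocked Q R e) (m : ℕ) :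
    ¬ WinsWithin E Turn.self m P Q := by
  induction m generalizing P Q R with
  | zero =>
    intro h
    cases h with
    | claimed e he heP =>
      rcases hE e he with ⟨q, hq, hqe⟩ | ⟨x, y, hxy, hx, hy⟩
      · exact hR.disj q (heP hqe) hq
      · exact hR.notMem_left x y hxy (heP hx)
  | succ m ih =>
    intro h
    cases h with
    | claimed e he heP =>
      rcases hE e he with ⟨q, hq, hqe⟩ | ⟨x, y, hxy, hx, hy⟩
      · exact hR.disj q (heP hqe) hq
      · exact hR.notMem_left x y hxy (heP hx)
    | move w hwP hwQ h =>
      cases h with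
      | claimed e he heP => exact (hE e he).not_subset hR w hwQ heP
      | reply hfree h =>
        -- The reply `y` is the partner of `w`, or arbitrary if `w` is unpaired. In the latter case
        -- the pair of `y` may be lost, but sets containing it are hit by `y`.
        have key : ∀ y, y ∉ insert w P → y ∉ Q → (∀ z, R w z → z = y) → False := by
          intro y hyP hyQ hy
          refine ih (P := insert w P) (Q := insert y Q) (R := eraseVertex (eraseVertex R y) w)
            ?_ ?_ (h y hyP hyQ)
          · refine ((((hR.erase y).insert_right (fun hP => hyP (Or.inr hP))
              (eraseVertex_self R y))).erase w).insert_left ?_ (eraseVertex_self _ w)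
            rintro (rfl | hw)
            · exact hyP (Or.inl rfl)
            · exact hwQ hw
          · intro e he
            rcases Blocked.insert_erase (w := y) (Or.inl (hE e he)) with h1 | ⟨p, q, hpq, hp, hq⟩
            · exact Or.inl h1
            · refine Or.inr ⟨p, q, ⟨hpq, ?_, ?_⟩, hp, hq⟩
              · rintro rfl
                exact hpq.2.2 (hy q hpq.1)
              · rintro rfl
                exact hpq.2.1 (hy p (hR.symm _ _ hpq.1))
        by_cases hw : ∃ y, R w y
        · obtain ⟨y, hy⟩ := hw
          have hy' := hR.symm _ _ hy
          refine key y ?_ (hR.notMem_right _ _ hy') fun z hz => hR.func _ _ _ hz hy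
          rintro (rfl | hP)
          · exact hR.ne _ _ hy rfl
          · exact hR.notMem_left _ _ hy' hP
        · obtain ⟨y, hyP, hyQ⟩ := hfree
          exact key y hyP hyQ fun z hz => (hw ⟨z, hz⟩).elim

/-- A pairing that blocks all winning sets except some that contain `y` suffices if the opponent
has just played `y`. -/
theorem IsPairing.not_winsWithin_insert (hR : IsPairing P Q R) {y : V} (hyP : y ∉ P)
    (hE : ∀ e ∈ E, Blocked Q R e ∨ y ∈ e) (m : ℕ) :
    ¬ WinsWithin E Turn.self m P (insert y Q) :=
  ((hR.erase y).insert_right hyP (eraseVertex_self R y)).not_winsWithin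
    (fun e he => Blocked.insert_erase (hE e he)) m

theorem not_winsWithin_succ {m : ℕ} (hfree : ∃ x, x ∉ P ∧ x ∉ Q)
    (h : ∀ x, x ∉ P → x ∉ Q → ∃ y, y ∉ insert x P ∧ y ∉ Q ∧
      ¬ WinsWithin E Turn.self m (insert x P) (insert y Q)) :
    ¬ WinsWithin E Turn.self (m + 1) P Q := by
  intro hw
  cases hw with
  | claimed e he heP =>
    obtain ⟨x, hxP, hxQ⟩ := hfree
    obtain ⟨y, -, -, hy⟩ := h x hxP hxQ
    exact hy (.claimed e he fun z hz => Or.inr (heP hz))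
  | move x hxP hxQ hx =>
    obtain ⟨y, hyP, hyQ, hy⟩ := h x hxP hxQ
    cases hx with
    | claimed e he heP => exact hy (.claimed e he heP)
    | reply _ hall => exact hy (hall y hyP hyQ)

/-! ### Strips: a pairing plus an unpaired path -/

/-- A pairing `R` of unplayed vertices together with a sequence of distinct unplayed vertices
`v a, …, v b` outside the pairing. -/
structure Strip (P Q : Set V) (R : V → V → Prop) (v : ℤ → V) (a b : ℤ) : Prop where
  pairing : IsPairing P Q R
  inj : ∀ i j, a ≤ i → i ≤ b → a ≤ j → j ≤ b → v i = v j → i = j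
  notMem_left : ∀ i, a ≤ i → i ≤ b → v i ∉ P
  notMem_right : ∀ i, a ≤ i → i ≤ b → v i ∉ Q
  unpaired : ∀ i, a ≤ i → i ≤ b → ∀ y, ¬ R (v i) y

theorem Strip.sub (h : Strip P Q R v a b) {c d : ℤ} (hc : a ≤ c) (hd : d ≤ b) :
    Strip P Q R v c d where
  pairing := h.pairing
  inj i j h1 h2 h3 h4 := h.inj i j (by omega) (by omega) (by omega) (by omega)
  notMem_left i h1 h2 := h.notMem_left i (by omega) (by omega)
  notMem_right i h1 h2 := h.notMem_right i (by omega) (by omega)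
  unpaired i h1 h2 := h.unpaired i (by omega) (by omega)

theorem Strip.neg (h : Strip P Q R v a b) : Strip P Q R (fun i => v (-i)) (-b) (-a) where
  pairing := h.pairing
  inj i j h1 h2 h3 h4 h5 := by
    have := h.inj (-i) (-j) (by omega) (by omega) (by omega) (by omega) h5
    omega
  notMem_left i h1 h2 := h.notMem_left _ (by omega) (by omega)
  notMem_right i h1 h2 := h.notMem_right _ (by omega) (by omega)
  unpaired i h1 h2 := h.unpaired _ (by omega) (by omega)

/-- Play two vertices of a strip and keep a part that does not contain them. -/
theorem Strip.move (h : Strip P Q R v a b) {c d i j : ℤ} (hc : a ≤ c) (hd : d ≤ b)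
    (hi : a ≤ i ∧ i ≤ b) (hj : a ≤ j ∧ j ≤ b) (hij : i ≠ j) (hi' : i < c ∨ d < i)
    (hj' : j < c ∨ d < j) : Strip (insert (v i) P) (insert (v j) Q) R v c d where
  pairing := by
    refine (h.pairing.insert_right (h.notMem_left j hj.1 hj.2)
      (h.unpaired j hj.1 hj.2)).insert_left ?_ (h.unpaired i hi.1 hi.2)
    rintro (h1 | h1)
    · exact hij (h.inj _ _ hi.1 hi.2 hj.1 hj.2 h1)
    · exact h.notMem_right i hi.1 hi.2 h1
  inj := (h.sub hc hd).inj
  notMem_left := by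
    rintro l h1 h2 (h3 | h3)
    · have := h.inj _ _ (by omega) (by omega) hi.1 hi.2 h3
      omega
    · exact h.notMem_left l (by omega) (by omega) h3
  notMem_right := by
    rintro l h1 h2 (h3 | h3)
    · have := h.inj _ _ (by omega) (by omega) hj.1 hj.2 h3
      omega
    · exact h.notMem_right l (by omega) (by omega) h3
  unpaired := (h.sub hc hd).unpaired

/-- Pair up an even number of consecutive vertices of a strip. -/
theorem Strip.pair (h : Strip P Q R v a b) {c d : ℤ} (hc : a ≤ c) (hd : d ≤ b)
    (hcd : c ≤ d + 1) (hpar : (d - c) % 2 = 1) :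
    ∃ R' : V → V → Prop, (∀ x y, R x y → R' x y) ∧ Strip P Q R' v a (c - 1) ∧
      Strip P Q R' v (d + 1) b ∧
      ∀ i, c ≤ i → i ≤ d → (c < i ∧ R' (v i) (v (i - 1))) ∨ (i < d ∧ R' (v i) (v (i + 1))) := by
  -- The new pairs are `(c, c + 1), …, (d - 1, d)`; the empty block `d = c - 1` is allowed.
  set R' : V → V → Prop := fun x y => R x y ∨ ∃ i, c ≤ i ∧ i + 1 ≤ d ∧ (i - c) % 2 = 0 ∧
    ((x = v i ∧ y = v (i + 1)) ∨ (x = v (i + 1) ∧ y = v i)) with hR'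
  have hdom : ∀ x y, R' x y → R x y ∨ ∃ i, c ≤ i ∧ i ≤ d ∧ x = v i := by
    rintro x y (h1 | ⟨i, h1, h2, -, ⟨h3, -⟩ | ⟨h3, -⟩⟩)
    · exact Or.inl h1
    · exact Or.inr ⟨i, h1, by omega, h3⟩
    · exact Or.inr ⟨i + 1, by omega, h2, h3⟩
  have hun : ∀ i, a ≤ i → i ≤ b → (i < c ∨ d < i) → ∀ y, ¬ R' (v i) y := by
    intro i h1 h2 h3 y h4
    rcases hdom _ _ h4 with h5 | ⟨j, h5, h6, h7⟩
    · exact h.unpaired i h1 h2 y h5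
    · have := h.inj _ _ h1 h2 (by omega) (by omega) h7
      omega
  have hinj : ∀ i j, c ≤ i → i ≤ d → c ≤ j → j ≤ d → v i = v j → i = j := fun i j h1 h2 h3 h4 =>
    h.inj i j (by omega) (by omega) (by omega) (by omega)
  have hpair : IsPairing P Q R' := by
    refine ⟨h.pairing.disj, ?_, ?_, ?_, ?_, ?_⟩
    · rintro x y (h1 | ⟨i, h1, h2, h3, h4⟩)
      · exact Or.inl (h.pairing.symm _ _ h1)
      · exact Or.inr ⟨i, h1, h2, h3, by tauto⟩
    · rintro x y (h1 | ⟨i, h1, h2, h3, ⟨rfl, rfl⟩ | ⟨rfl, rfl⟩⟩)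
      · exact h.pairing.ne _ _ h1
      · intro h4
        have := hinj _ _ (by omega) (by omega) (by omega) (by omega) h4
        omega
      · intro h4
        have := hinj _ _ (by omega) (by omega) (by omega) (by omega) h4
        omega
    · rintro x y z (h1 | ⟨i, h1, h2, h3, h4⟩) (h5 | ⟨j, h5, h6, h7, h8⟩)
      · exact h.pairing.func _ _ _ h1 h5
      · rcases h8 with ⟨rfl, -⟩ | ⟨rfl, -⟩
        · exact (h.unpaired _ (by omega) (by omega) _ h1).elim
        · exact (h.unpaired _ (by omega) (by omega) _ h1).elim
      · rcases h4 with ⟨rfl, -⟩ | ⟨rfl, -⟩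
        · exact (h.unpaired _ (by omega) (by omega) _ h5).elim
        · exact (h.unpaired _ (by omega) (by omega) _ h5).elim
      · rcases h4 with ⟨rfl, rfl⟩ | ⟨rfl, rfl⟩ <;> rcases h8 with ⟨h9, rfl⟩ | ⟨h9, rfl⟩ <;>
          have := hinj _ _ (by omega) (by omega) (by omega) (by omega) h9 <;>
          (congr 1; omega)
    · intro x y hxy
      rcases hdom _ _ hxy with h1 | ⟨i, h1, h2, rfl⟩
      · exact h.pairing.notMem_left _ _ h1
      · exact h.notMem_left i (by omega) (by omega)
    · intro x y hxy
      rcases hdom _ _ hxy with h1 | ⟨i, h1, h2, rfl⟩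
      · exact h.pairing.notMem_right _ _ h1
      · exact h.notMem_right i (by omega) (by omega)
  refine ⟨R', fun x y => Or.inl, ?_, ?_, ?_⟩
  · exact ⟨hpair, fun i j h1 h2 h3 h4 => h.inj i j h1 (by omega) h3 (by omega),
      fun i h1 h2 => h.notMem_left i h1 (by omega), fun i h1 h2 => h.notMem_right i h1 (by omega),
      fun i h1 h2 => hun i h1 (by omega) (by omega)⟩
  · exact ⟨hpair, fun i j h1 h2 h3 h4 => h.inj i j (by omega) h2 (by omega) h4,
      fun i h1 h2 => h.notMem_left i (by omega) h2, fun i h1 h2 => h.notMem_right i (by omega) h2,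
      fun i h1 h2 => hun i (by omega) h2 (by omega)⟩
  · intro i h1 h2
    rcases Int.emod_two_eq_zero_or_one (i - c) with h3 | h3
    · exact Or.inr ⟨by omega, Or.inr ⟨i, h1, by omega, h3, Or.inl ⟨rfl, rfl⟩⟩⟩
    · refine Or.inl ⟨by omega, Or.inr ⟨i - 1, by omega, by omega, by omega, Or.inr ⟨?_, rfl⟩⟩⟩
      rw [sub_add_cancel]

/-! ### Lower bound on paths -/

/-- `e` contains the closed neighborhood of a vertex of the path `v a, …, v b`. -/
def PathEdge (v : ℤ → V) (a b : ℤ) (e : Set V) : Prop :=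
  ∃ i, a ≤ i ∧ i ≤ b ∧ v i ∈ e ∧ (a < i → v (i - 1) ∈ e) ∧ (i < b → v (i + 1) ∈ e)

/-- `e` contains the closed neighborhood of a vertex of the graph consisting of the path
`v a, …, v (n - 1)` and the edge between `v 0` and `v (n - 1)`. -/
def TadpoleEdge (v : ℤ → V) (a n : ℤ) (e : Set V) : Prop :=
  ∃ i, a ≤ i ∧ i ≤ n - 1 ∧ v i ∈ e ∧ (a < i → v (i - 1) ∈ e) ∧ (i < n - 1 → v (i + 1) ∈ e) ∧
    (i = n - 1 → v 0 ∈ e) ∧ (i = 0 → v (n - 1) ∈ e)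

/-- Forgetting an edge shrinks the neighborhoods, which can only help Staller, so it is admissible
in a lower bound. -/
theorem TadpoleEdge.pathEdge {n : ℤ} {e : Set V} (h : TadpoleEdge v a n e) :
    PathEdge v a (n - 1) e := by
  obtain ⟨i, h1, h2, h3, h4, h5, -⟩ := h
  exact ⟨i, h1, h2, h3, h4, h5⟩

theorem PathEdge.neg {e : Set V} (h : PathEdge v a b e) :
    PathEdge (fun i => v (-i)) (-b) (-a) e := by
  obtain ⟨i, h1, h2, h3, h4, h5⟩ := h
  refine ⟨-i, by omega, by omega, by simpa using h3, fun h => ?_, fun h => ?_⟩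
  · convert h5 (by omega) using 2
    ring
  · convert h4 (by omega) using 2
    ring

/-- If the player takes a vertex of the strip that has an even number of vertices on either side,
the opponent can pair up the rest. -/
theorem Strip.reply_of_even (h : Strip P Q R v a b)
    (hE : ∀ e ∈ E, Blocked Q R e ∨ PathEdge v a b e) {j : ℤ} (hj : a ≤ j ∧ j ≤ b) (hab : a < b)
    (h1 : (j - a) % 2 = 0) (h2 : (b - j) % 2 = 0) (m : ℕ) :
    ∃ y, y ∉ insert (v j) P ∧ y ∉ Q ∧
      ¬ WinsWithin E Turn.self m (insert (v j) P) (insert y Q) := by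
  obtain ⟨R₁, hR₁, -, hs₁, hp₁⟩ := h.pair (c := a) (d := j - 1) (by omega) (by omega)
      (by omega) (by omega)
  rw [sub_add_cancel] at hs₁
  obtain ⟨R₂, hR₂, hs₂, -, hp₂⟩ := hs₁.pair (c := j + 1) (d := b) (by omega) (by omega)
      (by omega) (by omega)
  rw [add_sub_cancel_right] at hs₂
  have hpair : IsPairing (insert (v j) P) Q R₂ := hs₂.pairing.insert_left
    (h.notMem_right j hj.1 hj.2) (hs₂.unpaired j le_rfl le_rfl)
  -- The pairs leave only the neighborhood of `v j` open; a path neighbor `v l` of `v j` hits it.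
  obtain ⟨l, hl, hlj, hl'⟩ : ∃ l, (a ≤ l ∧ l ≤ b) ∧ l ≠ j ∧
      ∀ e : Set V, v j ∈ e → (a < j → v (j - 1) ∈ e) → (j < b → v (j + 1) ∈ e) → v l ∈ e := by
    by_cases hjb : j < b
    · exact ⟨j + 1, by omega, by omega, fun e _ _ h => h hjb⟩
    · exact ⟨j - 1, by omega, by omega, fun e _ h _ => h (by omega)⟩
  have hlP : v l ∉ insert (v j) P := by
    rintro (h3 | h3)
    · exact hlj (h.inj _ _ hl.1 hl.2 hj.1 hj.2 h3)
    · exact h.notMem_left l hl.1 hl.2 h3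
  refine ⟨v l, hlP, h.notMem_right l hl.1 hl.2, hpair.not_winsWithin_insert hlP ?_ m⟩
  intro e he
  rcases hE e he with h3 | ⟨i, h3, h4, h5, h6, h7⟩
  · exact Or.inl (h3.mono subset_rfl fun x y hxy => hR₂ _ _ (hR₁ _ _ hxy))
  · rcases lt_trichotomy i j with hi | rfl | hi
    · left; right
      rcases hp₁ i h3 (by omega) with ⟨h8, h9⟩ | ⟨h8, h9⟩
      · exact ⟨_, _, hR₂ _ _ h9, h5, h6 h8⟩
      · exact ⟨_, _, hR₂ _ _ h9, h5, h7 (by omega)⟩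
    · exact Or.inr (hl' e h5 h6 h7)
    · left; right
      rcases hp₂ i (by omega) h4 with ⟨h8, h9⟩ | ⟨h8, h9⟩
      · exact ⟨_, _, h9, h5, h6 (by omega)⟩
      · exact ⟨_, _, h9, h5, h7 h8⟩

/-- The opponent answers every move outside a strip with an odd number of vertices; it suffices to
consider moves in the strip. -/
theorem Strip.not_winsWithin_succ (h : Strip P Q R v a b) {F : Set V → Prop}
    (hF : ∀ e, F e → PathEdge v a b e) (hE : ∀ e ∈ E, Blocked Q R e ∨ F e) (hab : a ≤ b)
    (hpar : (b - a) % 2 = 0) {m : ℕ}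
    (hind : ∀ P' Q' R', Strip P' Q' R' v a b → (∀ e ∈ E, Blocked Q' R' e ∨ F e) →
      ¬ WinsWithin E Turn.self m P' Q')
    (hcore : ∀ j, a ≤ j → j ≤ b → ∃ y, y ∉ insert (v j) P ∧ y ∉ Q ∧
      ¬ WinsWithin E Turn.self m (insert (v j) P) (insert y Q)) :
    ¬ WinsWithin E Turn.self (m + 1) P Q := by
  refine _root_.not_winsWithin_succ
    ⟨v a, h.notMem_left a le_rfl hab, h.notMem_right a le_rfl hab⟩ ?_
  intro x hxP hxQ
  by_cases hx : ∃ j, a ≤ j ∧ j ≤ b ∧ x = v j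
  · obtain ⟨j, h1, h2, rfl⟩ := hx
    exact hcore j h1 h2
  have hvx : ∀ i, a ≤ i → i ≤ b → v i ≠ x := fun i h1 h2 h3 => hx ⟨i, h1, h2, h3.symm⟩
  by_cases hxR : ∃ y, R x y
  · obtain ⟨y, hy⟩ := hxR
    have hy' := h.pairing.symm _ _ hy
    have hvy : ∀ i, a ≤ i → i ≤ b → v i ≠ y := by
      rintro i h1 h2 rfl
      exact h.unpaired i h1 h2 _ hy'
    have hyP : y ∉ insert x P := by
      rintro (rfl | h1)
      · exact h.pairing.ne _ _ hy rfl
      · exact h.pairing.notMem_left _ _ hy' h1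
    refine ⟨y, hyP, h.pairing.notMem_right _ _ hy',
      hind _ _ (eraseVertex (eraseVertex R y) x) ?_ ?_⟩
    · refine ⟨?_, h.inj, ?_, ?_, ?_⟩
      · refine ((((h.pairing.erase y).insert_right (fun hP => hyP (Or.inr hP))
          (eraseVertex_self R y))).erase x).insert_left ?_ (eraseVertex_self _ x)
        rintro (rfl | hw)
        · exact hyP (Or.inl rfl)
        · exact hxQ hw
      · rintro i h1 h2 (h3 | h3)
        · exact hvx i h1 h2 h3
        · exact h.notMem_left i h1 h2 h3
      · rintro i h1 h2 (h3 | h3)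
        · exact hvy i h1 h2 h3
        · exact h.notMem_right i h1 h2 h3
      · exact fun i h1 h2 z h3 => h.unpaired i h1 h2 z h3.1.1
    · intro e he
      rcases hE e he with h1 | h1
      · left
        rcases Blocked.insert_erase (w := y) (Or.inl h1) with h1 | ⟨p, q, hpq, hp, hq⟩
        · exact Or.inl h1
        · refine Or.inr ⟨p, q, ⟨hpq, ?_, ?_⟩, hp, hq⟩
          · rintro rfl
            exact hpq.2.2 (h.pairing.func _ _ _ hpq.1 hy)
          · rintro rfl
            exact hpq.2.1 (h.pairing.func _ _ _ (h.pairing.symm _ _ hpq.1) hy)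
      · exact Or.inr h1
  -- Here `x` is a wasted move, in no pair and not in the strip. Taking `v a` leaves an even path,
  -- which is paired completely.
  · obtain ⟨R', hR', hs, -, hp⟩ := h.pair (c := a + 1) (d := b) (by omega) (by omega)
      (by omega) (by omega)
    have haP : v a ∉ insert x P := by
      rintro (h1 | h1)
      · exact hvx a le_rfl hab h1
      · exact h.notMem_left a le_rfl hab h1
    refine ⟨v a, haP, h.notMem_right a le_rfl hab, ?_⟩
    have hpair : IsPairing (insert x P) Q (eraseVertex R' x) :=
      (hs.pairing.erase x).insert_left hxQ (eraseVertex_self _ x)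
    refine hpair.not_winsWithin_insert haP ?_ m
    intro e he
    rcases hE e he with (h1 | ⟨p, q, hpq, hp, hq⟩) | h1
    · exact Or.inl (Or.inl h1)
    · refine Or.inl (Or.inr ⟨p, q, ⟨hR' _ _ hpq, ?_, ?_⟩, hp, hq⟩)
      · rintro rfl
        exact hxR ⟨_, hpq⟩
      · rintro rfl
        exact hxR ⟨_, h.pairing.symm _ _ hpq⟩
    · obtain ⟨i, h3, h4, h5, h6, h7⟩ := hF e h1
      rcases eq_or_lt_of_le h3 with rfl | hi
      · exact Or.inr h5
      · left; right
        rcases hp i (by omega) h4 with ⟨h8, h9⟩ | ⟨h8, h9⟩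
        · exact ⟨_, _, ⟨h9, hvx _ (by omega) (by omega), hvx _ (by omega) (by omega)⟩, h5,
            h6 (by omega)⟩
        · exact ⟨_, _, ⟨h9, hvx _ (by omega) (by omega), hvx _ (by omega) (by omega)⟩, h5, h7 h8⟩

/-- If the player takes `v j`, the opponent can take `v (j + 1)` and pair up the vertices after it,
keeping only the path before `v j`. -/
theorem Strip.keep_left (h : Strip P Q R v a b) {F : Set V → Prop}
    (hE : ∀ e ∈ E, Blocked Q R e ∨ F e) {j : ℤ} (hj : a ≤ j ∧ j + 1 ≤ b)
    (hpar : (b - j) % 2 = 1) {F' : Set V → Prop}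
    (hF : ∀ e, F e → F' e ∨ PathEdge v (j + 1) b e ∨ v (j + 1) ∈ e) {m : ℕ}
    (hind : ∀ P' Q' R', Strip P' Q' R' v a (j - 1) → (∀ e ∈ E, Blocked Q' R' e ∨ F' e) →
      ¬ WinsWithin E Turn.self m P' Q') :
    ∃ y, y ∉ insert (v j) P ∧ y ∉ Q ∧
      ¬ WinsWithin E Turn.self m (insert (v j) P) (insert y Q) := by
  obtain ⟨R₁, hR₁, hs₁, -, hp₁⟩ := h.pair (c := j + 2) (d := b) (by omega) (by omega)
      (by omega) (by omega)
  have hs₂ := hs₁.move (c := a) (d := j - 1) (i := j) (j := j + 1) (by omega) (by omega)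
    (by omega) (by omega) (by omega) (by omega) (by omega)
  refine ⟨v (j + 1), ?_, h.notMem_right _ (by omega) (by omega), hind _ _ R₁ hs₂ ?_⟩
  · rintro (h3 | h3)
    · have := h.inj _ _ (by omega) (by omega) (by omega) (by omega) h3
      omega
    · exact h.notMem_left _ (by omega) (by omega) h3
  intro e he
  rcases hE e he with h3 | h3
  · exact Or.inl (h3.mono (Set.subset_insert _ _) hR₁)
  rcases hF e h3 with h3 | ⟨i, h3, h4, h5, h6, h7⟩ | h3
  · exact Or.inr h3
  · left
    rcases eq_or_lt_of_le h3 with rfl | hi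
    · exact Or.inl ⟨_, Or.inl rfl, h5⟩
    · right
      rcases hp₁ i (by omega) h4 with ⟨h8, h9⟩ | ⟨h8, h9⟩
      · exact ⟨_, _, h9, h5, h6 (by omega)⟩
      · exact ⟨_, _, h9, h5, h7 (by omega)⟩
  · exact Or.inl (Or.inl ⟨_, Or.inl rfl, h3⟩)

/-- The mirror image of `Strip.keep_left` under `i ↦ -i`. -/
theorem Strip.keep_right (h : Strip P Q R v a b) {F : Set V → Prop}
    (hE : ∀ e ∈ E, Blocked Q R e ∨ F e) {j : ℤ} (hj : a ≤ j - 1 ∧ j ≤ b)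
    (hpar : (j - a) % 2 = 1) {F' : Set V → Prop}
    (hF : ∀ e, F e → F' e ∨ PathEdge v a (j - 1) e ∨ v (j - 1) ∈ e) {m : ℕ}
    (hind : ∀ P' Q' R', Strip P' Q' R' v (j + 1) b → (∀ e ∈ E, Blocked Q' R' e ∨ F' e) →
      ¬ WinsWithin E Turn.self m P' Q') :
    ∃ y, y ∉ insert (v j) P ∧ y ∉ Q ∧
      ¬ WinsWithin E Turn.self m (insert (v j) P) (insert y Q) := by
  have := h.neg.keep_left hE (j := -j) (F' := F') (m := m) (by omega) (by omega) ?_ ?_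
  · simpa using this
  · intro e he
    rcases hF e he with h1 | h1 | h1
    · exact Or.inl h1
    · refine Or.inr (Or.inl ?_)
      convert h1.neg using 1
      ring
    · refine Or.inr (Or.inr ?_)
      convert h1 using 2
      ring
  · intro P' Q' R' hs
    refine hind P' Q' R' ?_
    have := hs.neg
    simp only [neg_neg] at this
    convert this using 1
    ring

/-- On a path with an odd number `≥ 2 ^ m` of vertices the player cannot win within `m` moves. -/
theorem Strip.path_not_winsWithin {m : ℕ} (h : Strip P Q R v a b)
    (hE : ∀ e ∈ E, Blocked Q R e ∨ PathEdge v a b e) (hab : a ≤ b) (hpar : (b - a) % 2 = 0)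
    (hm : 2 ^ m ≤ b - a + 1) : ¬ WinsWithin E Turn.self m P Q := by
  induction m generalizing P Q R a b with
  | zero =>
    intro hw
    cases hw with
    | claimed e he heP =>
      rcases hE e he with (⟨q, hq, hqe⟩ | ⟨x, y, hxy, hx, hy⟩) | ⟨i, h1, h2, h3, -⟩
      · exact h.pairing.disj q (heP hqe) hq
      · exact h.pairing.notMem_left x y hxy (heP hx)
      · exact h.notMem_left i h1 h2 (heP h3)
  | succ m ih =>
    rw [pow_succ] at hm
    have h2m : (1 : ℤ) ≤ 2 ^ m := one_le_pow₀ (by norm_num)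
    refine h.not_winsWithin_succ (F := PathEdge v a b) (fun _ => id) hE hab hpar ?_ ?_
    · exact fun P' Q' R' h' hE' => ih h' hE' hab hpar (by omega)
    intro j h1 h2
    rcases Int.emod_two_eq_zero_or_one (j - a) with h3 | h3
    · exact h.reply_of_even hE ⟨h1, h2⟩ (by omega) h3 (by omega) m
    -- The two pieces have at least `2 * 2 ^ m - 1` vertices together, so one of them has at least
    -- `2 ^ m`.
    by_cases h4 : 2 ^ m ≤ j - a
    · refine h.keep_left hE (j := j) (F' := PathEdge v a (j - 1)) (by omega) (by omega) ?_
        fun P' Q' R' h' hE' => ih h' hE' (by omega) (by omega) (by omega)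
      rintro e ⟨i, h5, h6, h7, h8, h9⟩
      rcases lt_trichotomy i j with hi | rfl | hi
      · exact Or.inl ⟨i, h5, by omega, h7, h8, fun _ => h9 (by omega)⟩
      · exact Or.inr (Or.inr (h9 (by omega)))
      · exact Or.inr (Or.inl ⟨i, by omega, h6, h7, fun _ => h8 (by omega), h9⟩)
    · refine h.keep_right hE (j := j) (F' := PathEdge v (j + 1) b) (by omega) (by omega) ?_
        fun P' Q' R' h' hE' => ih h' hE' (by omega) (by omega) (by omega)
      rintro e ⟨i, h5, h6, h7, h8, h9⟩
      rcases lt_trichotomy i j with hi | rfl | hi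
      · exact Or.inr (Or.inl ⟨i, h5, by omega, h7, h8, fun _ => h9 (by omega)⟩)
      · exact Or.inr (Or.inr (h8 (by omega)))
      · exact Or.inl ⟨i, by omega, h6, h7, fun _ => h8 (by omega), h9⟩

/-! ### Lower bound on tadpoles -/

/-- The reflection of the cycle `v 0, …, v (n - 1)` that fixes `v 0`. -/
def reflectCycle (v : ℤ → V) (n i : ℤ) : V := if i ≤ 0 then v i else v (n - i)

theorem Strip.reflect {n : ℤ} (h : Strip P Q R v a (n - 1)) (ha : a ≤ 0) :
    Strip P Q R (reflectCycle v n) a (n - 1) := by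
  refine ⟨h.pairing, ?_, ?_, ?_, ?_⟩
  · intro i j h1 h2 h3 h4 h5
    unfold reflectCycle at h5
    split_ifs at h5 <;>
      have := h.inj _ _ (by omega) (by omega) (by omega) (by omega) h5 <;> omega
  · intro i h1 h2
    unfold reflectCycle
    split_ifs <;> exact h.notMem_left _ (by omega) (by omega)
  · intro i h1 h2
    unfold reflectCycle
    split_ifs <;> exact h.notMem_right _ (by omega) (by omega)
  · intro i h1 h2
    unfold reflectCycle
    split_ifs <;> exact h.unpaired _ (by omega) (by omega)

/-- The reflection is an automorphism fixing the tail. It exchanges the two Hamiltonian paths from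
the end of the tail and moves the cycle position `j` to `n - j`. -/
theorem TadpoleEdge.reflect {n : ℤ} {e : Set V} (h : TadpoleEdge v a n e) (ha : a ≤ 0)
    (hn : 3 ≤ n) : TadpoleEdge (reflectCycle v n) a n e := by
  obtain ⟨i, h1, h2, h3, h4, h5, h6, h7⟩ := h
  have hpos : ∀ j, 0 < j → reflectCycle v n j = v (n - j) := fun j hj => if_neg (by omega)
  have hneg : ∀ j, j ≤ 0 → reflectCycle v n j = v j := fun j hj => if_pos hj
  rcases lt_trichotomy i 0 with hi | rfl | hi
  · refine ⟨i, h1, h2, ?_, ?_, ?_, by omega, by omega⟩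
    · rwa [hneg _ (by omega)]
    · rwa [hneg _ (by omega)]
    · rwa [hneg _ (by omega)]
  · refine ⟨0, h1, h2, ?_, ?_, ?_, by omega, ?_⟩
    · rwa [hneg _ (by omega)]
    · rwa [hneg _ (by omega)]
    · rw [hpos _ (by omega)]
      simpa using fun _ => h7 rfl
    · rw [hpos _ (by omega)]
      simpa using h5 (by omega)
  · refine ⟨n - i, by omega, by omega, ?_, ?_, ?_, ?_, by omega⟩
    · rw [hpos _ (by omega)]
      simpa using h3
    · intro _
      by_cases hin : i = n - 1
      · rw [hneg _ (by omega)]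
        convert h6 hin using 2
        omega
      · rw [hpos _ (by omega)]
        convert h5 (by omega) using 2
        omega
    · intro _
      rw [hpos _ (by omega)]
      convert h4 (by omega) using 2
      omega
    · intro _
      rw [hneg _ (by omega)]
      convert h4 (by omega) using 2
      omega

/-- On a tadpole with an even cycle and an odd tail, the player needs many moves. -/
theorem Strip.tadpole_not_winsWithin {n : ℤ} {L m : ℕ} (h : Strip P Q R v a (n - 1))
    (hE : ∀ e ∈ E, Blocked Q R e ∨ TadpoleEdge v a n e) (ha : a < 0) (hn : 3 ≤ n)
    (hn2 : n % 2 = 0) (ha2 : a % 2 = 1) (hL : 2 ^ L < 2 * n)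
    (hm : 2 * 2 ^ m < n - 2 * a + 2 ^ L + 2) : ¬ WinsWithin E Turn.self m P Q := by
  induction m generalizing P Q R a with
  | zero =>
    intro hw
    cases hw with
    | claimed e he heP =>
      rcases hE e he with (⟨q, hq, hqe⟩ | ⟨x, y, hxy, hx, hy⟩) | ⟨i, h1, h2, h3, -⟩
      · exact h.pairing.disj q (heP hqe) hq
      · exact h.pairing.notMem_left x y hxy (heP hx)
      · exact h.notMem_left i h1 h2 (heP h3)
  | succ m ih =>
    have h2m : (1 : ℤ) ≤ 2 ^ m := one_le_pow₀ (by norm_num)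
    have hm' : 4 * 2 ^ m < n - 2 * a + 2 ^ L + 2 := by
      rw [pow_succ] at hm
      omega
    -- With this comparison of powers, the size estimates below become linear.
    have hpow : (2 : ℤ) ^ L ≤ 2 ^ m ∨ (2 : ℤ) ^ L = 2 * 2 ^ m ∨ 4 * (2 : ℤ) ^ m ≤ 2 ^ L := by
      rcases lt_trichotomy L (m + 1) with h1 | rfl | h1
      · exact Or.inl (pow_le_pow_right₀ (by norm_num) (by omega))
      · exact Or.inr (Or.inl (pow_succ' 2 m))
      · refine Or.inr (Or.inr ?_)
        calc (4 : ℤ) * 2 ^ m = 2 ^ (m + 2) := by ring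
          _ ≤ 2 ^ L := pow_le_pow_right₀ (by norm_num) (by omega)
    refine h.not_winsWithin_succ (F := TadpoleEdge v a n) (fun e he => he.pathEdge) hE (by omega)
      (by omega) ?_ ?_
    · refine fun P' Q' R' h' hE' => ih h' hE' ha ha2 ?_
      omega
    intro j h1 h2
    rcases Int.emod_two_eq_zero_or_one (j - a) with h3 | h3
    · exact h.reply_of_even (fun e he => (hE e he).imp_right TadpoleEdge.pathEdge) ⟨h1, h2⟩
        (by omega) h3 (by omega) m
    -- Stated for any numbering `w`, to serve the reflected cycle as well.
    have keep_path : ∀ (w : ℤ → V) (j : ℤ), Strip P Q R w a (n - 1) →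
        (∀ e ∈ E, Blocked Q R e ∨ TadpoleEdge w a n e) → a ≤ j → j + 1 ≤ n - 1 →
        (j - a) % 2 = 1 → 2 ^ m ≤ j - a → ∃ y, y ∉ insert (w j) P ∧ y ∉ Q ∧
          ¬ WinsWithin E Turn.self m (insert (w j) P) (insert y Q) := by
      intro w j hw hEw h1 h2 h3 h4
      refine hw.keep_left hEw (j := j) (F' := PathEdge w a (j - 1)) (by omega) (by omega) ?_
        fun P' Q' R' h' hE' => h'.path_not_winsWithin hE' (by omega) (by omega) (by omega)
      rintro e ⟨i, h5, h6, h7, h8, h9, -⟩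
      rcases lt_trichotomy i j with hi | rfl | hi
      · exact Or.inl ⟨i, h5, by omega, h7, h8, fun _ => h9 (by omega)⟩
      · exact Or.inr (Or.inr (h9 (by omega)))
      · exact Or.inr (Or.inl ⟨i, by omega, h6, h7, fun _ => h8 (by omega), h9⟩)
    by_cases h4 : 2 ^ m ≤ j - a
    · exact keep_path v j h hE h1 (by omega) h3 h4
    -- Now the piece before `j` is too short. For `j < 0` the tail loses at most `2 ^ m` vertices,
    -- so the bound drops by at most `2 * 2 ^ m`. For `j = 0` the other `n - 1` cycle vertices are
    -- enough. For `j > 0` the tail, `v 0` and the other arc are.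
    rcases lt_trichotomy j 0 with hj | rfl | hj
    · refine h.keep_right hE (j := j) (F' := TadpoleEdge v (j + 1) n) (by omega) (by omega) ?_
        fun P' Q' R' h' hE' => ih h' hE' (by omega) (by omega) (by omega)
      rintro e ⟨i, h5, h6, h7, h8, h9, h10⟩
      rcases lt_trichotomy i j with hi | rfl | hi
      · exact Or.inr (Or.inl ⟨i, h5, by omega, h7, h8, fun _ => h9 (by omega)⟩)
      · exact Or.inr (Or.inr (h8 (by omega)))
      · exact Or.inl ⟨i, by omega, h6, h7, fun _ => h8 (by omega), h9, h10⟩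
    · refine h.keep_right hE (j := 0) (F' := PathEdge v (0 + 1) (n - 1)) (by omega) (by omega) ?_
        fun P' Q' R' h' hE' => h'.path_not_winsWithin hE' (by omega) (by omega) (by omega)
      rintro e ⟨i, h5, h6, h7, h8, h9, -⟩
      rcases lt_trichotomy i 0 with hi | rfl | hi
      · exact Or.inr (Or.inl ⟨i, h5, by omega, h7, h8, fun _ => h9 (by omega)⟩)
      · exact Or.inr (Or.inr (h8 (by omega)))
      · exact Or.inl ⟨i, by omega, h6, h7, fun _ => h8 (by omega), h9⟩
    · have := keep_path _ (n - j) (h.reflect ha.le)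
        (fun e he => (hE e he).imp_right fun h => h.reflect ha.le hn) (by omega) (by omega)
        (by omega) (by omega)
      simpa [reflectCycle, show ¬ n ≤ j by omega] using this

/-- On a tadpole with an odd cycle and an even tail, the player cannot win. -/
theorem Strip.tadpole_not_winsWithin_of_odd {n : ℤ} {m : ℕ} (h : Strip P Q R v a (n - 1))
    (hE : ∀ e ∈ E, Blocked Q R e ∨ TadpoleEdge v a n e) (ha : a ≤ 0) (hn : 3 ≤ n)
    (hn2 : n % 2 = 1) (ha2 : a % 2 = 0) : ¬ WinsWithin E Turn.self m P Q := by
  induction m generalizing P Q R a with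
  | zero =>
    intro hw
    cases hw with
    | claimed e he heP =>
      rcases hE e he with (⟨q, hq, hqe⟩ | ⟨x, y, hxy, hx, hy⟩) | ⟨i, h1, h2, h3, -⟩
      · exact h.pairing.disj q (heP hqe) hq
      · exact h.pairing.notMem_left x y hxy (heP hx)
      · exact h.notMem_left i h1 h2 (heP h3)
  | succ m ih =>
    refine h.not_winsWithin_succ (F := TadpoleEdge v a n) (fun e he => he.pathEdge) hE (by omega)
      (by omega) (fun P' Q' R' h' hE' => ih h' hE' ha ha2) ?_
    intro j h1 h2
    rcases Int.emod_two_eq_zero_or_one (j - a) with h3 | h3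
    · exact h.reply_of_even (fun e he => (hE e he).imp_right TadpoleEdge.pathEdge) ⟨h1, h2⟩
        (by omega) h3 (by omega) m
    rcases lt_or_ge j 0 with hj | hj
    · refine h.keep_right hE (j := j) (F' := TadpoleEdge v (j + 1) n) (by omega) (by omega) ?_
        fun P' Q' R' h' hE' => ih h' hE' (by omega) (by omega)
      rintro e ⟨i, h5, h6, h7, h8, h9, h10⟩
      rcases lt_trichotomy i j with hi | rfl | hi
      · exact Or.inr (Or.inl ⟨i, h5, by omega, h7, h8, fun _ => h9 (by omega)⟩)
      · exact Or.inr (Or.inr (h8 (by omega)))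
      · exact Or.inl ⟨i, by omega, h6, h7, fun _ => h8 (by omega), h9, h10⟩
    -- As `n` is odd, `n - j` and `j` differ in parity: after reflection both sides of the move are
    -- even.
    · have := (h.reflect ha).reply_of_even
        (fun e he => (hE e he).imp_right fun h => (h.reflect ha hn).pathEdge)
        (j := n - j) (by omega) (by omega) (by omega) (by omega) m
      simpa [reflectCycle, show ¬ n ≤ j by omega] using this

end Breaker

/-! ### Staller's strategy on paths -/

section Maker

variable {V : Type*} {E : Set (Set V)} {P Q : Set V} {v : ℤ → V} {a b n : ℤ}

/-- `v a, …, v b` are distinct unplayed vertices. -/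
structure FreeSeq (P Q : Set V) (v : ℤ → V) (a b : ℤ) : Prop where
  inj : ∀ i j, a ≤ i → i ≤ b → a ≤ j → j ≤ b → v i = v j → i = j
  notMem_left : ∀ i, a ≤ i → i ≤ b → v i ∉ P
  notMem_right : ∀ i, a ≤ i → i ≤ b → v i ∉ Q

theorem FreeSeq.move (h : FreeSeq P Q v a b) {c d j : ℤ} {w : V} (hc : a ≤ c) (hd : d ≤ b)
    (hj : a ≤ j ∧ j ≤ b) (hj' : j < c ∨ d < j) (hw : ∀ i, c ≤ i → i ≤ d → w ≠ v i) :
    FreeSeq (insert (v j) P) (insert w Q) v c d where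
  inj i j h1 h2 h3 h4 := h.inj i j (by omega) (by omega) (by omega) (by omega)
  notMem_left := by
    rintro i h1 h2 (h3 | h3)
    · have := h.inj _ _ (by omega) (by omega) hj.1 hj.2 h3
      omega
    · exact h.notMem_left i (by omega) (by omega) h3
  notMem_right := by
    rintro i h1 h2 (h3 | h3)
    · exact hw i h1 h2 h3.symm
    · exact h.notMem_right i (by omega) (by omega) h3

theorem FreeSeq.notMem_insert (h : FreeSeq P Q v a b) {i j : ℤ} (hi : a ≤ i ∧ i ≤ b)
    (hj : a ≤ j ∧ j ≤ b) (hij : i ≠ j) : v i ∉ insert (v j) P ∧ v i ∉ Q := by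
  refine ⟨?_, h.notMem_right i hi.1 hi.2⟩
  rintro (h3 | h3)
  · exact hij (h.inj _ _ hi.1 hi.2 hj.1 hj.2 h3)
  · exact h.notMem_left i hi.1 hi.2 h3

/-- Some winning set lies in `P` and the closed neighborhood of `v i` in the path `v a, …, v b`. -/
def HasPathEdge (E : Set (Set V)) (P : Set V) (v : ℤ → V) (a b i : ℤ) : Prop :=
  ∃ e ∈ E, ∀ x ∈ e, x ∈ P ∨ x = v i ∨ (a < i ∧ x = v (i - 1)) ∨ (i < b ∧ x = v (i + 1))

theorem WinsWithin.move_reply {m : ℕ} (x : V) (hxP : x ∉ P) (hxQ : x ∉ Q)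
    (hfree : ∃ w, w ∉ insert x P ∧ w ∉ Q)
    (h : ∀ w, w ∉ insert x P → w ∉ Q → WinsWithin E Turn.self m (insert x P) (insert w Q)) :
    WinsWithin E Turn.self (m + 1) P Q :=
  .move x hxP hxQ (.reply hfree h)

/-- On a path with an odd number `< 2 ^ m` of vertices the player wins within `m` moves. -/
theorem FreeSeq.path_winsWithin {m : ℕ} (h : FreeSeq P Q v a b)
    (hE : ∀ i, a ≤ i → i ≤ b → (i - a) % 2 = 0 → HasPathEdge E P v a b i) (hab : a ≤ b)
    (hpar : (b - a) % 2 = 0) (hm : b - a + 2 ≤ 2 ^ m) : WinsWithin E Turn.self m P Q := by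
  induction m generalizing P Q a b with
  | zero => simp at hm; omega
  | succ m ih =>
    rw [pow_succ] at hm
    have h2m : (1 : ℤ) ≤ 2 ^ m := one_le_pow₀ (by norm_num)
    rcases eq_or_lt_of_le hab with rfl | hlt
    · obtain ⟨e, he, hx⟩ := hE a le_rfl le_rfl (by omega)
      refine .move (v a) (h.notMem_left a le_rfl le_rfl) (h.notMem_right a le_rfl le_rfl)
        (.claimed e he fun x hxe => ?_)
      rcases hx x hxe with h1 | h1 | ⟨h1, -⟩ | ⟨h1, -⟩
      · exact Or.inr h1
      · exact Or.inl h1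
      · omega
      · omega
    have h2m' : (2 : ℤ) ^ m % 2 = 0 := by
      rcases m with _ | m
      · simp at hm; omega
      · rw [pow_succ]; omega
    -- Both pieces are to be odd with at most `2 ^ m - 1` vertices. As `j` is at odd distance from
    -- `a`, the positions at even distance stay so within each piece.
    obtain ⟨j, h1, h2, h3, h4, h5⟩ : ∃ j, a < j ∧ j < b ∧ (j - a) % 2 = 1 ∧
        j - a + 1 ≤ 2 ^ m ∧ b - j + 1 ≤ 2 ^ m := by
      by_cases h6 : b - a ≤ 2 ^ m
      · exact ⟨a + 1, by omega, by omega, by omega, by omega, by omega⟩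
      · exact ⟨a + 2 ^ m - 1, by omega, by omega, by omega, by omega, by omega⟩
    refine .move_reply (v j) (h.notMem_left j h1.le h2.le) (h.notMem_right j h1.le h2.le)
      ⟨v a, h.notMem_insert (by omega) (by omega) (by omega)⟩ fun w hwP hwQ => ?_
    by_cases hw : ∃ i, a ≤ i ∧ i ≤ j - 1 ∧ w = v i
    · obtain ⟨l, hl1, hl2, rfl⟩ := hw
      refine ih (a := j + 1) (b := b) (h.move (by omega) le_rfl (by omega) (by omega) ?_) ?_
        (by omega) (by omega) (by omega)
      · intro i h6 h7 h8
        have := h.inj _ _ (by omega) (by omega) (by omega) (by omega) h8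
        omega
      · intro i h6 h7 h8
        obtain ⟨e, he, hx⟩ := hE i (by omega) h7 (by omega)
        refine ⟨e, he, fun x hxe => ?_⟩
        rcases hx x hxe with h9 | h9 | ⟨h9, h10⟩ | ⟨h9, h10⟩
        · exact Or.inl (Or.inr h9)
        · exact Or.inr (Or.inl h9)
        · rcases eq_or_lt_of_le h6 with rfl | h11
          · rw [add_sub_cancel_right] at h10
            exact Or.inl (Or.inl h10)
          · exact Or.inr (Or.inr (Or.inl ⟨h11, h10⟩))
        · exact Or.inr (Or.inr (Or.inr ⟨h9, h10⟩))
    · refine ih (a := a) (b := j - 1) (h.move le_rfl (by omega) (by omega) (by omega)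
        fun i h6 h7 h8 => hw ⟨i, h6, h7, h8⟩) ?_ (by omega) (by omega) (by omega)
      intro i h6 h7 h8
      obtain ⟨e, he, hx⟩ := hE i h6 (by omega) (by omega)
      refine ⟨e, he, fun x hxe => ?_⟩
      rcases hx x hxe with h9 | h9 | ⟨h9, h10⟩ | ⟨h9, h10⟩
      · exact Or.inl (Or.inr h9)
      · exact Or.inr (Or.inl h9)
      · exact Or.inr (Or.inr (Or.inl ⟨h9, h10⟩))
      · by_cases h11 : i < j - 1
        · exact Or.inr (Or.inr (Or.inr ⟨h11, h10⟩))
        · rw [show i + 1 = j by omega] at h10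
          exact Or.inl (Or.inl h10)

/-! ### Staller's strategy on tadpoles -/

/-- Some winning set lies in `P` and the closed neighborhood of `v i` in the graph consisting of the
path `v a, …, v (n - 1)` and the edge between `v 0` and `v (n - 1)`. -/
def HasTadpoleEdge (E : Set (Set V)) (P : Set V) (v : ℤ → V) (a n i : ℤ) : Prop :=
  ∃ e ∈ E, ∀ x ∈ e, x ∈ P ∨ x = v i ∨ (a < i ∧ x = v (i - 1)) ∨ (i < n - 1 ∧ x = v (i + 1)) ∨
    (i = n - 1 ∧ x = v 0) ∨ (i = 0 ∧ x = v (n - 1))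

theorem FreeSeq.reflect (h : FreeSeq P Q v a (n - 1)) (ha : a ≤ 0) :
    FreeSeq P Q (reflectCycle v n) a (n - 1) := by
  refine ⟨?_, ?_, ?_⟩
  · intro i j h1 h2 h3 h4 h5
    unfold reflectCycle at h5
    split_ifs at h5 <;>
      have := h.inj _ _ (by omega) (by omega) (by omega) (by omega) h5 <;> omega
  · intro i h1 h2
    unfold reflectCycle
    split_ifs <;> exact h.notMem_left _ (by omega) (by omega)
  · intro i h1 h2
    unfold reflectCycle
    split_ifs <;> exact h.notMem_right _ (by omega) (by omega)

/-- The hypothesis is needed at all positions, because a position `i > 0` draws on it at `n - i`. -/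
theorem HasTadpoleEdge.reflect (hn : 3 ≤ n)
    (hE : ∀ i, a ≤ i → i ≤ n - 1 → HasTadpoleEdge E P v a n i) (ha : a ≤ 0) (i : ℤ)
    (h1 : a ≤ i) (h2 : i ≤ n - 1) : HasTadpoleEdge E P (reflectCycle v n) a n i := by
  have hpos : ∀ j, 0 < j → reflectCycle v n j = v (n - j) := fun j hj => if_neg (by omega)
  have hneg : ∀ j, j ≤ 0 → reflectCycle v n j = v j := fun j hj => if_pos hj
  rcases lt_trichotomy i 0 with hi | rfl | hi
  · obtain ⟨e, he, hx⟩ := hE i h1 h2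
    refine ⟨e, he, fun x hxe => ?_⟩
    rw [hneg i hi.le, hneg (i - 1) (by omega), hneg (i + 1) (by omega)]
    rcases hx x hxe with h | h | h | h | h | h
    · exact Or.inl h
    · exact Or.inr (Or.inl h)
    · exact Or.inr (Or.inr (Or.inl h))
    · exact Or.inr (Or.inr (Or.inr (Or.inl h)))
    · omega
    · omega
  · obtain ⟨e, he, hx⟩ := hE 0 h1 h2
    refine ⟨e, he, fun x hxe => ?_⟩
    rw [hneg 0 le_rfl, hneg (0 - 1) (by omega), hpos (0 + 1) (by omega), hpos (n - 1) (by omega)]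
    rw [show n - (n - 1) = 0 + 1 by ring, zero_add]
    rcases hx x hxe with h | h | h | h | h | h
    · exact Or.inl h
    · exact Or.inr (Or.inl h)
    · exact Or.inr (Or.inr (Or.inl h))
    · exact Or.inr (Or.inr (Or.inr (Or.inr (Or.inr ⟨rfl, h.2⟩))))
    · omega
    · exact Or.inr (Or.inr (Or.inr (Or.inl ⟨by omega, h.2⟩)))
  · obtain ⟨e, he, hx⟩ := hE (n - i) (by omega) (by omega)
    refine ⟨e, he, fun x hxe => ?_⟩
    rw [hpos i hi]
    rcases hx x hxe with h | h | h | h | h | h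
    · exact Or.inl h
    · exact Or.inr (Or.inl h)
    · by_cases h3 : i = n - 1
      · refine Or.inr (Or.inr (Or.inr (Or.inr (Or.inl ⟨h3, ?_⟩))))
        rw [hneg 0 le_rfl, h.2]
        congr 1
        omega
      · refine Or.inr (Or.inr (Or.inr (Or.inl ⟨by omega, ?_⟩)))
        rw [hpos _ (by omega), h.2]
        congr 1
        omega
    · refine Or.inr (Or.inr (Or.inl ⟨by omega, ?_⟩))
      rw [hpos _ (by omega), h.2]
      congr 1
      omega
    · refine Or.inr (Or.inr (Or.inl ⟨by omega, ?_⟩))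
      rw [hneg _ (by omega), h.2]
      congr 1
      omega
    · omega

/-- If the player has taken the cycle vertex `v i`, and the opponent has not replied on the path
`v a, …, v (i - 1)`, then the player wins on this path. -/
theorem FreeSeq.cycle_move_winsWithin {m : ℕ} {i : ℤ} {w : V} (h : FreeSeq P Q v a (n - 1))
    (hE : ∀ i, a ≤ i → i ≤ n - 1 → HasTadpoleEdge E P v a n i) (ha2 : a % 2 = 1)
    (hin : i < n) (hi2 : i % 2 = 0) (hai : a < i) (hm : i - a + 1 ≤ 2 ^ m)
    (hw : ∀ j, a ≤ j → j ≤ i - 1 → w ≠ v j) :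
    WinsWithin E Turn.self m (insert (v i) P) (insert w Q) := by
  refine FreeSeq.path_winsWithin (a := a) (b := i - 1)
    (h.move le_rfl (by omega) (by omega) (by omega) hw) ?_ (by omega) (by omega) (by omega)
  intro j h1 h2 h3
  obtain ⟨e, he, hx⟩ := hE j h1 (by omega)
  refine ⟨e, he, fun x hxe => ?_⟩
  rcases hx x hxe with h4 | h4 | h4 | h4 | h4 | h4
  · exact Or.inl (Or.inr h4)
  · exact Or.inr (Or.inl h4)
  · exact Or.inr (Or.inr (Or.inl h4))
  · by_cases h5 : j < i - 1
    · exact Or.inr (Or.inr (Or.inr ⟨h5, h4.2⟩))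
    · rw [show j + 1 = i by omega] at h4
      exact Or.inl (Or.inl h4.2)
  · omega
  · omega

/-- A move in the middle of the cycle. -/
theorem FreeSeq.cycle_winsWithin {m : ℕ} {i : ℤ} (h : FreeSeq P Q v a (n - 1))
    (hE : ∀ i, a ≤ i → i ≤ n - 1 → HasTadpoleEdge E P v a n i) (ha : a < 0) (ha2 : a % 2 = 1)
    (hn2 : n % 2 = 0) (hi : 3 ≤ i) (hin : i + 2 ≤ n) (hi2 : i % 2 = 0)
    (hm : i - a + 1 ≤ 2 ^ m) (hm' : n - i - a + 1 ≤ 2 ^ m) :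
    WinsWithin E Turn.self (m + 1) P Q := by
  refine .move_reply (v i) (h.notMem_left i (by omega) (by omega))
    (h.notMem_right i (by omega) (by omega))
    ⟨v 0, h.notMem_insert (by omega) (by omega) (by omega)⟩ fun w hwP hwQ => ?_
  by_cases hw : ∀ j, a ≤ j → j ≤ i - 1 → w ≠ v j
  · exact h.cycle_move_winsWithin hE ha2 (by omega) hi2 (by omega) hm hw
  by_cases hw' : ∀ j, a ≤ j → j ≤ n - i - 1 → w ≠ reflectCycle v n j
  · have := (h.reflect ha.le).cycle_move_winsWithin (i := n - i) (m := m)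
      (HasTadpoleEdge.reflect (by omega) hE ha.le) ha2 (by omega) (by omega) (by omega)
      hm' hw'
    simpa [reflectCycle, show ¬ n ≤ i by omega] using this
  -- The reply hits both paths. Each consists of the tail, `v 0` and one arc up to `v i`, so the
  -- reply is in the tail or is `v 0`, and the surroundings of `v i` are intact.
  push Not at hw hw'
  obtain ⟨j, h1, h2, rfl⟩ := hw
  obtain ⟨j', h3, h4, h5⟩ := hw'
  have hj : j ≤ 0 := by
    by_contra hj
    unfold reflectCycle at h5
    split_ifs at h5 <;>
      have := h.inj _ _ (by omega) (by omega) (by omega) (by omega) h5 <;> omega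
  have hm2 : (2 : ℤ) ^ 2 ≤ 2 ^ m := by norm_num; omega
  have hne : ∀ l, 0 < l → l ≤ n - 1 → l ≠ i →
      v l ∉ insert (v i) P ∧ v l ∉ insert (v j) Q := by
    intro l h6 h7 h8
    refine ⟨(h.notMem_insert (by omega) (by omega) h8).1, ?_⟩
    rintro (h9 | h9)
    · have := h.inj _ _ (by omega) (by omega) (by omega) (by omega) h9
      omega
    · exact h.notMem_right l (by omega) (by omega) h9
  -- With `v i` owned, `v (i - 2), v (i - 1), v (i + 1)` acts as a path on three vertices: playing
  -- `v (i - 1)` threatens the neighborhoods of `v (i - 1)` and of `v i` at once.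
  let f : ℤ → ℤ := fun t => if t = 0 then i - 2 else if t = 1 then i - 1 else i + 1
  have hf : ∀ t, 0 < f t ∧ f t ≤ n - 1 ∧ f t ≠ i := by
    intro t
    dsimp only [f]
    split_ifs <;> omega
  refine FreeSeq.path_winsWithin (v := fun t => v (f t)) (a := 0) (b := 2) ⟨?_, ?_, ?_⟩ ?_
    (by omega) (by omega) (by norm_num at hm2; omega)
  · intro s t h6 h7 h8 h9 h10
    have h11 := h.inj (f s) (f t) (by linarith [(hf s).1]) (hf s).2.1 (by linarith [(hf t).1])
      (hf t).2.1 h10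
    dsimp only [f] at h11
    split_ifs at h11 <;> omega
  · exact fun t _ _ => (hne (f t) (hf t).1 (hf t).2.1 (hf t).2.2).1
  · exact fun t _ _ => (hne (f t) (hf t).1 (hf t).2.1 (hf t).2.2).2
  · intro t h6 h7 h8
    obtain rfl | rfl : t = 0 ∨ t = 2 := by omega
    · obtain ⟨e, he, hx⟩ := hE (i - 1) (by omega) (by omega)
      refine ⟨e, he, fun x hxe => ?_⟩
      rcases hx x hxe with h9 | h9 | h9 | h9 | h9 | h9
      · exact Or.inl (Or.inr h9)
      · exact Or.inr (Or.inr (Or.inr ⟨by omega, by simp [f, h9]⟩))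
      · refine Or.inr (Or.inl ?_)
        rw [h9.2]
        simp only [f, if_true]
        congr 1
        ring
      · left; left
        rw [h9.2]
        congr 1
        ring
      · omega
      · omega
    · obtain ⟨e, he, hx⟩ := hE i (by omega) (by omega)
      refine ⟨e, he, fun x hxe => ?_⟩
      rcases hx x hxe with h9 | h9 | h9 | h9 | h9 | h9
      · exact Or.inl (Or.inr h9)
      · exact Or.inl (Or.inl h9)
      · exact Or.inr (Or.inr (Or.inl ⟨by omega, by simp [f, h9.2]⟩))
      · exact Or.inr (Or.inl (by simp [f, h9.2]))
      · omega
      · omega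

/-- On a tadpole with an even cycle and an odd tail, the player wins within the stated number of
moves. -/
theorem FreeSeq.tadpole_winsWithin {m L : ℕ} (h : FreeSeq P Q v a (n - 1))
    (hE : ∀ i, a ≤ i → i ≤ n - 1 → HasTadpoleEdge E P v a n i) (ha : a < 0) (ha2 : a % 2 = 1)
    (hn : 3 ≤ n) (hn2 : n % 2 = 0) (hL : n ≤ 2 ^ L) (hL' : 2 ^ L < 2 * n)
    (hm : n - 2 * a + 2 ^ L + 2 ≤ 2 * 2 ^ m) : WinsWithin E Turn.self m P Q := by
  induction m generalizing P Q a with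
  | zero => simp at hm; omega
  | succ m ih =>
    have hm1 : n - 2 * a + 2 ^ L + 2 ≤ 4 * 2 ^ m := by
      rw [pow_succ] at hm
      omega
    have h2m : (2 : ℤ) ^ m % 2 = 0 := by
      rcases m with _ | m
      · simp at hm1; omega
      · rw [pow_succ]; omega
    rcases Nat.lt_or_ge m L with hmL | hmL
    · have hmL' : 2 * (2 : ℤ) ^ m ≤ 2 ^ L := by
        calc 2 * (2 : ℤ) ^ m = 2 ^ (m + 1) := by ring
          _ ≤ 2 ^ L := pow_le_pow_right₀ (by norm_num) (by omega)
      -- `i` is `n / 2` rounded up to an even number. If rounding occurs, `n - 2 * a` is divisible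
      -- by 4, as is `2 * 2 ^ m`; this supplies the missing 2 in `i - a + 1 ≤ 2 ^ m`.
      obtain ⟨i, hi⟩ : ∃ i, i % 2 = 0 ∧ (n = 2 * i ∨ n = 2 * i - 2) := by
        rcases Int.emod_two_eq_zero_or_one (n / 2) with h1 | h1
        · exact ⟨n / 2, by omega, by omega⟩
        · exact ⟨n / 2 + 1, by omega, by omega⟩
      have hn6 : n ≠ 4 := by
        rintro rfl
        have : (2 : ℤ) ^ L ≤ 2 ^ 2 := by
          refine pow_le_pow_right₀ (by norm_num) ?_
          by_contra hL3
          have : (2 : ℤ) ^ 3 ≤ 2 ^ L := pow_le_pow_right₀ (by norm_num) (by omega)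
          norm_num at this
          omega
        norm_num at this
        omega
      exact h.cycle_winsWithin hE ha ha2 hn2 (i := i) (by omega) (by omega) (by omega) (by omega)
        (by omega)
    have hmL' : (2 : ℤ) ^ L ≤ 2 ^ m := pow_le_pow_right₀ (by norm_num) hmL
    -- For a short tail, `v 0` leaves two odd paths, the tail and the rest of the cycle, each with
    -- fewer than `2 ^ m` vertices.
    by_cases hk : -a < 2 ^ m
    · refine .move_reply (v 0) (h.notMem_left 0 (by omega) (by omega))
        (h.notMem_right 0 (by omega) (by omega))
        ⟨v 1, h.notMem_insert (by omega) (by omega) (by omega)⟩ fun w hwP hwQ => ?_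
      by_cases hw : ∃ i, a ≤ i ∧ i ≤ -1 ∧ w = v i
      · obtain ⟨l, hl1, hl2, rfl⟩ := hw
        refine FreeSeq.path_winsWithin (a := 1) (b := n - 1)
          (h.move (by omega) le_rfl (by omega) (by omega) ?_) ?_ (by omega) (by omega) (by omega)
        · intro i h6 h7 h8
          have := h.inj _ _ (by omega) (by omega) (by omega) (by omega) h8
          omega
        · intro i h6 h7 h8
          obtain ⟨e, he, hx⟩ := hE i (by omega) h7
          refine ⟨e, he, fun x hxe => ?_⟩
          rcases hx x hxe with h9 | h9 | h9 | h9 | h9 | h9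
          · exact Or.inl (Or.inr h9)
          · exact Or.inr (Or.inl h9)
          · rcases eq_or_lt_of_le h6 with rfl | h11
            · exact Or.inl (Or.inl h9.2)
            · exact Or.inr (Or.inr (Or.inl ⟨h11, h9.2⟩))
          · exact Or.inr (Or.inr (Or.inr h9))
          · exact Or.inl (Or.inl h9.2)
          · omega
      · refine FreeSeq.path_winsWithin (a := a) (b := -1)
          (h.move le_rfl (by omega) (by omega) (by omega)
            fun i h6 h7 h8 => hw ⟨i, h6, h7, h8⟩) ?_ (by omega) (by omega) (by omega)
        intro i h6 h7 h8
        obtain ⟨e, he, hx⟩ := hE i h6 (by omega)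
        refine ⟨e, he, fun x hxe => ?_⟩
        rcases hx x hxe with h9 | h9 | h9 | h9 | h9 | h9
        · exact Or.inl (Or.inr h9)
        · exact Or.inr (Or.inl h9)
        · exact Or.inr (Or.inr (Or.inl h9))
        · by_cases h11 : i < -1
          · exact Or.inr (Or.inr (Or.inr ⟨h11, h9.2⟩))
          · rw [show i + 1 = 0 by omega] at h9
            exact Or.inl (Or.inl h9.2)
        · omega
        · omega
    -- This cuts off `2 ^ m - 1` tail vertices. The other piece is a tadpole whose tail is shorter
    -- by `2 ^ m`, so the bound drops by exactly `2 * 2 ^ m`. The tail stays nonempty, since `a` is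
    -- odd and `2 ^ m` even.
    · obtain ⟨j, hj⟩ : ∃ j, j = a + 2 ^ m - 1 := ⟨_, rfl⟩
      refine .move_reply (v j) (h.notMem_left j (by omega) (by omega))
        (h.notMem_right j (by omega) (by omega))
        ⟨v 1, h.notMem_insert (by omega) (by omega) (by omega)⟩ fun w hwP hwQ => ?_
      by_cases hw : ∃ i, a ≤ i ∧ i ≤ j - 1 ∧ w = v i
      · obtain ⟨l, hl1, hl2, rfl⟩ := hw
        refine ih (a := j + 1)
          (h.move (by omega) le_rfl (by omega) (by omega) ?_) ?_ (by omega) (by omega) (by omega)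
        · intro i h6 h7 h8
          have := h.inj _ _ (by omega) (by omega) (by omega) (by omega) h8
          omega
        · intro i h6 h7
          obtain ⟨e, he, hx⟩ := hE i (by omega) h7
          refine ⟨e, he, fun x hxe => ?_⟩
          rcases hx x hxe with h9 | h9 | h9 | h9
          · exact Or.inl (Or.inr h9)
          · exact Or.inr (Or.inl h9)
          · rcases eq_or_lt_of_le h6 with rfl | h11
            · rw [add_sub_cancel_right] at h9
              exact Or.inl (Or.inl h9.2)
            · exact Or.inr (Or.inr (Or.inl ⟨h11, h9.2⟩))
          · exact Or.inr (Or.inr (Or.inr h9))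
      · refine FreeSeq.path_winsWithin (a := a) (b := j - 1)
          (h.move le_rfl (by omega) (by omega) (by omega)
            fun i h6 h7 h8 => hw ⟨i, h6, h7, h8⟩) ?_ (by omega) (by omega) (by omega)
        intro i h6 h7 h8
        obtain ⟨e, he, hx⟩ := hE i h6 (by omega)
        refine ⟨e, he, fun x hxe => ?_⟩
        rcases hx x hxe with h9 | h9 | h9 | h9 | h9 | h9
        · exact Or.inl (Or.inr h9)
        · exact Or.inr (Or.inl h9)
        · exact Or.inr (Or.inr (Or.inl h9))
        · by_cases h11 : i < j - 1
          · exact Or.inr (Or.inr (Or.inr ⟨h11, h9.2⟩))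
          · rw [show i + 1 = j by omega] at h9
            exact Or.inl (Or.inl h9.2)
        · omega
        · omega

end Maker

/-! ### Dominator's pairing win and the winning numbers -/

section Domination

variable {V : Type*} {E : Set (Set V)} {P Q : Set V} {R : V → V → Prop}

/-- A player with a pairing that blocks all sets of `E` can claim a transversal of `E`. -/
theorem IsPairing.winsWithin_transversal [Finite V] (hR : IsPairing P Q R)
    (hE : ∀ e ∈ E, Blocked P R e) {m : ℕ} (hm : {x | x ∉ P ∧ x ∉ Q}.ncard ≤ m) :
    WinsWithin {D : Set V | ∀ e ∈ E, ∃ x ∈ D, x ∈ e} Turn.opponent m P Q := by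
  induction m generalizing P Q R with
  | zero =>
    have hempty := (Set.ncard_eq_zero (Set.toFinite _)).1 (Nat.le_zero.1 hm)
    refine .claimed P (fun e he => ?_) subset_rfl
    rcases hE e he with h | ⟨x, y, hxy, -, -⟩
    · exact h
    · have : x ∈ {x | x ∉ P ∧ x ∉ Q} := ⟨hR.notMem_left x y hxy, hR.notMem_right x y hxy⟩
      rw [hempty] at this
      exact this.elim
  | succ m ih =>
    by_cases hfree : ∃ w, w ∉ P ∧ w ∉ Q
    swap
    · refine .claimed P (fun e he => ?_) subset_rfl
      rcases hE e he with h | ⟨x, y, hxy, -, -⟩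
      · exact h
      · exact (hfree ⟨x, hR.notMem_left x y hxy, hR.notMem_right x y hxy⟩).elim
    refine .reply hfree fun w hwP hwQ => ?_
    have key : ∀ y, y ∉ P → y ∉ insert w Q → (∀ z, R w z → z = y) →
        WinsWithin {D : Set V | ∀ e ∈ E, ∃ x ∈ D, x ∈ e} Turn.self (m + 1) P (insert w Q) := by
      intro y hyP hyQ hy
      refine .move y hyP hyQ (ih (R := eraseVertex (eraseVertex R y) w) ?_ ?_ ?_)
      · refine ((((hR.erase y).insert_left (fun hQ => hyQ (Or.inr hQ))
          (eraseVertex_self R y))).erase w).insert_right ?_ (eraseVertex_self _ w)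
        rintro (rfl | hw)
        · exact hyQ (Or.inl rfl)
        · exact hwP hw
      · intro e he
        rcases Blocked.insert_erase (w := y) (Or.inl (hE e he)) with h1 | ⟨p, q, hpq, hp, hq⟩
        · exact Or.inl h1
        · refine Or.inr ⟨p, q, ⟨hpq, ?_, ?_⟩, hp, hq⟩
          · rintro rfl
            exact hpq.2.2 (hy q hpq.1)
          · rintro rfl
            exact hpq.2.1 (hy p (hR.symm _ _ hpq.1))
      · refine Nat.le_of_lt_succ (lt_of_lt_of_le (Set.ncard_lt_ncard ⟨?_, ?_⟩) hm)
        · exact fun x hx => ⟨fun h => hx.1 (Or.inr h), fun h => hx.2 (Or.inr h)⟩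
        · exact fun h => (h ⟨hwP, hwQ⟩ : w ∈ {x | x ∉ insert y P ∧ x ∉ insert w Q}).2 (Or.inl rfl)
    by_cases hw : ∃ y, R w y
    · obtain ⟨y, hy⟩ := hw
      have hy' := hR.symm _ _ hy
      refine key y (hR.notMem_left _ _ hy') ?_ fun z hz => hR.func _ _ _ hz hy
      rintro (rfl | hQ)
      · exact hR.ne _ _ hy rfl
      · exact hR.notMem_right _ _ hy' hQ
    by_cases hfree' : ∃ y, y ∉ P ∧ y ∉ insert w Q
    · obtain ⟨y, hyP, hyQ⟩ := hfree'
      exact key y hyP hyQ fun z hz => (hw ⟨z, hz⟩).elim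
    · refine .claimed P (fun e he => ?_) subset_rfl
      rcases hE e he with h | ⟨x, y, hxy, -, -⟩
      · exact h
      · refine (hfree' ⟨x, hR.notMem_left x y hxy, ?_⟩).elim
        rintro (rfl | h)
        · exact hw ⟨y, hxy⟩
        · exact hR.notMem_right x y hxy h

/-- Adjacency is symmetric, so `D` dominates `x` exactly when `D` meets `N[x]`. Hence a pairing that
stops Staller also makes Dominator win. -/
theorem dominatingSets_eq_transversals (G : SimpleGraph V) :
    dominatingSets G = {D : Set V | ∀ e ∈ closedNbhdHypergraph G, ∃ x ∈ D, x ∈ e} := by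
  ext D
  simp only [dominatingSets, closedNbhdHypergraph, Set.mem_ofPred_eq, Set.eq_univ_iff_forall,
    Set.mem_iUnion, Set.forall_mem_range, exists_prop]
  refine forall_congr' fun x => exists_congr fun y => and_congr_right fun _ => ?_
  simp only [closedNbhd, Set.mem_insert_iff, SimpleGraph.mem_neighborSet]
  rw [eq_comm, G.adj_comm]

theorem dominatorWinsDGame_of_isPairing [Finite V] (G : SimpleGraph V) (hR : IsPairing ∅ ∅ R)
    (y : V) (hE : ∀ e ∈ closedNbhdHypergraph G, Blocked ∅ R e ∨ y ∈ e) :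
    DominatorWinsDGame G := by
  refine ⟨{x | x ∉ insert y (∅ : Set V) ∧ x ∉ (∅ : Set V)}.ncard + 1,
    .move y (Set.notMem_empty y) (Set.notMem_empty y) ?_⟩
  rw [dominatingSets_eq_transversals]
  exact ((hR.erase y).insert_left (Set.notMem_empty y)
    (eraseVertex_self R y)).winsWithin_transversal
    (fun e he => Blocked.insert_erase (hE e he)) le_rfl

theorem not_closedNbhd_subset_empty {G : SimpleGraph V} {e : Set V}
    (he : e ∈ closedNbhdHypergraph G) : ¬ e ⊆ ∅ := by
  rintro h
  obtain ⟨x, rfl⟩ := he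
  exact h (Set.mem_insert x _)

theorem winningNumber_eq_top {t : Turn} (h : ∀ m, ¬ WinsWithin E t m ∅ ∅) :
    winningNumber E t = ⊤ := by
  refine sInf_eq_top.2 ?_
  rintro x ⟨m, -, hm⟩
  exact (h m hm).elim

theorem winningNumber_eq_coe {t : Turn} {M : ℕ} (h : ∀ m, WinsWithin E t m ∅ ∅ → M ≤ m)
    (hM : WinsWithin E t M ∅ ∅) : winningNumber E t = (M : ℕ∞) := by
  refine le_antisymm (sInf_le ⟨M, rfl, hM⟩) (le_sInf ?_)
  rintro x ⟨m, rfl, hm⟩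
  exact_mod_cast h m hm

theorem gammaSMB_eq_top_of_isPairing (G : SimpleGraph V) (hR : IsPairing ∅ ∅ R)
    (y : V) (hE : ∀ e ∈ closedNbhdHypergraph G, Blocked ∅ R e ∨ y ∈ e) : gammaSMB G = ⊤ := by
  refine winningNumber_eq_top fun m h => ?_
  cases h with
  | claimed e he heP => exact not_closedNbhd_subset_empty he heP
  | reply _ h =>
    exact hR.not_winsWithin_insert (Set.notMem_empty y) hE m
      (h y (Set.notMem_empty y) (Set.notMem_empty y))

end Domination

/-! ### The tadpole graph in Hamiltonian path coordinates -/

section Tadpole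

variable {n k : ℕ}

/-- The vertices of the tadpole graph, numbered along a Hamiltonian path: first the tail
`-k, …, -1`, from its end to the cycle, then the cycle `0, …, n - 1`. -/
def tadpoleVertex (n k : ℕ) (hn : 3 ≤ n) (hk : 1 ≤ k) (i : ℤ) : Fin n ⊕ Fin k :=
  if 0 ≤ i then Sum.inl ⟨i.toNat % n, Nat.mod_lt _ (by omega)⟩
  else Sum.inr ⟨(-i - 1).toNat % k, Nat.mod_lt _ (by omega)⟩

/-- The reductions modulo `n` and `k` only make `tadpoleVertex` total; they do nothing for `-k ≤ i ≤
n - 1`. -/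
theorem tadpoleVertex_of_nonneg (hn : 3 ≤ n) (hk : 1 ≤ k) {i : ℤ} (h : 0 ≤ i) (h' : i ≤ n - 1) :
    tadpoleVertex n k hn hk i = Sum.inl ⟨i.toNat, by omega⟩ := by
  rw [tadpoleVertex, if_pos h]
  congr 2
  exact Nat.mod_eq_of_lt (by omega)

theorem tadpoleVertex_of_neg (hn : 3 ≤ n) (hk : 1 ≤ k) {i : ℤ} (h : -k ≤ i) (h' : i < 0) :
    tadpoleVertex n k hn hk i = Sum.inr ⟨(-i - 1).toNat, by omega⟩ := by
  rw [tadpoleVertex, if_neg (by omega)]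
  congr 2
  exact Nat.mod_eq_of_lt (by omega)

theorem exists_tadpoleVertex_eq (hn : 3 ≤ n) (hk : 1 ≤ k) (x : Fin n ⊕ Fin k) :
    ∃ i : ℤ, -k ≤ i ∧ i ≤ n - 1 ∧ tadpoleVertex n k hn hk i = x := by
  rcases x with x | x
  · refine ⟨x, by omega, by omega, ?_⟩
    rw [tadpoleVertex_of_nonneg hn hk (by omega) (by omega)]
    simp
  · refine ⟨-x - 1, by omega, by omega, ?_⟩
    rw [tadpoleVertex_of_neg hn hk (by omega) (by omega)]
    simp

theorem tadpoleVertex_inj (hn : 3 ≤ n) (hk : 1 ≤ k) (i j : ℤ) (hi : -k ≤ i) (hi' : i ≤ n - 1)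
    (hj : -k ≤ j) (hj' : j ≤ n - 1)
    (h : tadpoleVertex n k hn hk i = tadpoleVertex n k hn hk j) : i = j := by
  rcases lt_or_ge i 0 with h1 | h1 <;> rcases lt_or_ge j 0 with h2 | h2
  · rw [tadpoleVertex_of_neg hn hk hi h1, tadpoleVertex_of_neg hn hk hj h2] at h
    simp only [Sum.inr.injEq, Fin.mk.injEq] at h
    omega
  · rw [tadpoleVertex_of_neg hn hk hi h1, tadpoleVertex_of_nonneg hn hk h2 hj'] at h
    simp at h
  · rw [tadpoleVertex_of_nonneg hn hk h1 hi', tadpoleVertex_of_neg hn hk hj h2] at h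
    simp at h
  · rw [tadpoleVertex_of_nonneg hn hk h1 hi', tadpoleVertex_of_nonneg hn hk h2 hj'] at h
    simp only [Sum.inl.injEq, Fin.mk.injEq] at h
    omega

theorem cycleGraph_adj_iff (x y : Fin n) (hn : 3 ≤ n) :
    (SimpleGraph.cycleGraph n).Adj x y ↔ (y : ℕ) = x + 1 ∨ (x : ℕ) = y + 1 ∨
      ((x : ℕ) = 0 ∧ (y : ℕ) = n - 1) ∨ ((x : ℕ) = n - 1 ∧ (y : ℕ) = 0) := by
  rw [SimpleGraph.cycleGraph_adj']
  rcases lt_trichotomy x y with h | rfl | h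
  · rw [Fin.coe_sub_iff_lt.2 h, Fin.coe_sub_iff_le.2 h.le]
    rw [Fin.lt_def] at h
    omega
  · rw [Fin.coe_sub_iff_le.2 le_rfl]
    omega
  · rw [Fin.coe_sub_iff_lt.2 h, Fin.coe_sub_iff_le.2 h.le]
    rw [Fin.lt_def] at h
    omega

theorem tadpoleGraph_adj_iff (hn : 3 ≤ n) (hk : 1 ≤ k) {i j : ℤ} (hi : -k ≤ i)
    (hi' : i ≤ n - 1) (hj : -k ≤ j) (hj' : j ≤ n - 1) :
    (tadpoleGraph n k hn hk).Adj (tadpoleVertex n k hn hk i) (tadpoleVertex n k hn hk j) ↔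
      j = i + 1 ∨ i = j + 1 ∨ (i = 0 ∧ j = n - 1) ∨ (i = n - 1 ∧ j = 0) := by
  rw [tadpoleGraph, SimpleGraph.sup_adj, SimpleGraph.edge_adj]
  rcases lt_or_ge i 0 with h1 | h1 <;> rcases lt_or_ge j 0 with h2 | h2
  · rw [tadpoleVertex_of_neg hn hk hi h1, tadpoleVertex_of_neg hn hk hj h2,
      SimpleGraph.sum_adj_inr, SimpleGraph.pathGraph_adj]
    simp
    omega
  · rw [tadpoleVertex_of_neg hn hk hi h1, tadpoleVertex_of_nonneg hn hk h2 hj']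
    simp [SimpleGraph.sum]
    omega
  · rw [tadpoleVertex_of_nonneg hn hk h1 hi', tadpoleVertex_of_neg hn hk hj h2]
    simp [SimpleGraph.sum]
    omega
  · rw [tadpoleVertex_of_nonneg hn hk h1 hi', tadpoleVertex_of_nonneg hn hk h2 hj',
      SimpleGraph.sum_adj_inl, cycleGraph_adj_iff _ _ hn]
    simp
    omega

theorem tadpoleEdge_of_mem (hn : 3 ≤ n) (hk : 1 ≤ k) (e : Set (Fin n ⊕ Fin k))
    (he : e ∈ closedNbhdHypergraph (tadpoleGraph n k hn hk)) :
    TadpoleEdge (tadpoleVertex n k hn hk) (-k) n e := by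
  obtain ⟨x, rfl⟩ := he
  obtain ⟨i, hi, hi', rfl⟩ := exists_tadpoleVertex_eq hn hk x
  refine ⟨i, hi, hi', Or.inl rfl, fun h => Or.inr ?_, fun h => Or.inr ?_, fun h => Or.inr ?_,
    fun h => Or.inr ?_⟩ <;>
  · rw [SimpleGraph.mem_neighborSet,
      tadpoleGraph_adj_iff hn hk hi hi' (by omega) (by omega)]
    omega

theorem hasTadpoleEdge_closedNbhd (hn : 3 ≤ n) (hk : 1 ≤ k) (P : Set (Fin n ⊕ Fin k)) (i : ℤ)
    (hi : -k ≤ i) (hi' : i ≤ n - 1) :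
    HasTadpoleEdge (closedNbhdHypergraph (tadpoleGraph n k hn hk)) P (tadpoleVertex n k hn hk)
      (-k) n i := by
  refine ⟨_, ⟨tadpoleVertex n k hn hk i, rfl⟩, ?_⟩
  rintro x (rfl | hx)
  · exact Or.inr (Or.inl rfl)
  obtain ⟨j, hj, hj', rfl⟩ := exists_tadpoleVertex_eq hn hk x
  rw [SimpleGraph.mem_neighborSet, tadpoleGraph_adj_iff hn hk hi hi' hj hj'] at hx
  rcases hx with rfl | rfl | ⟨rfl, rfl⟩ | ⟨rfl, rfl⟩
  · exact Or.inr (Or.inr (Or.inr (Or.inl ⟨by omega, rfl⟩)))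
  · exact Or.inr (Or.inr (Or.inl ⟨by omega, by rw [add_sub_cancel_right]⟩))
  · exact Or.inr (Or.inr (Or.inr (Or.inr (Or.inr ⟨rfl, rfl⟩))))
  · exact Or.inr (Or.inr (Or.inr (Or.inr (Or.inl ⟨rfl, rfl⟩))))

theorem tadpole_strip (hn : 3 ≤ n) (hk : 1 ≤ k) :
    Strip ∅ ∅ (fun _ _ => False) (tadpoleVertex n k hn hk) (-k) (n - 1) where
  pairing := by constructor <;> simp
  inj := tadpoleVertex_inj hn hk
  notMem_left _ _ _ := Set.notMem_empty _
  notMem_right _ _ _ := Set.notMem_empty _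
  unpaired _ _ _ _ := id

theorem tadpole_freeSeq (hn : 3 ≤ n) (hk : 1 ≤ k) :
    FreeSeq ∅ ∅ (tadpoleVertex n k hn hk) (-k) (n - 1) where
  inj := tadpoleVertex_inj hn hk
  notMem_left _ _ _ := Set.notMem_empty _
  notMem_right _ _ _ := Set.notMem_empty _

theorem exists_tadpole_isPairing_of_even (hn : 3 ≤ n) (hk : 1 ≤ k) (hnk : Even (n + k)) :
    ∃ R, IsPairing ∅ ∅ R ∧
      ∀ e ∈ closedNbhdHypergraph (tadpoleGraph n k hn hk), Blocked ∅ R e := by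
  rw [Nat.even_iff] at hnk
  obtain ⟨R, -, hs, -, hp⟩ := (tadpole_strip hn hk).pair (c := -k) (d := n - 1) le_rfl le_rfl
    (by omega) (by omega)
  refine ⟨R, hs.pairing, fun e he => Or.inr ?_⟩
  obtain ⟨i, h1, h2, h3, h4, h5⟩ := (tadpoleEdge_of_mem hn hk e he).pathEdge
  rcases hp i h1 h2 with ⟨h6, h7⟩ | ⟨h6, h7⟩
  · exact ⟨_, _, h7, h3, h4 h6⟩
  · exact ⟨_, _, h7, h3, h5 h6⟩

theorem exists_tadpole_isPairing (hn : 3 ≤ n) (hk : 1 ≤ k) :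
    ∃ R y, IsPairing ∅ ∅ R ∧
      ∀ e ∈ closedNbhdHypergraph (tadpoleGraph n k hn hk), Blocked ∅ R e ∨ y ∈ e := by
  by_cases hnk : Even (n + k)
  · obtain ⟨R, hR, hE⟩ := exists_tadpole_isPairing_of_even hn hk hnk
    exact ⟨R, tadpoleVertex n k hn hk 0, hR, fun e he => Or.inl (hE e he)⟩
  rw [Nat.even_iff] at hnk
  -- For odd `n + k` the end of the tail stays unpaired; it is Dominator's first move.
  obtain ⟨R, -, hs, -, hp⟩ := (tadpole_strip hn hk).pair (c := -k + 1) (d := n - 1) (by omega)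
    le_rfl (by omega) (by omega)
  refine ⟨R, tadpoleVertex n k hn hk (-k), hs.pairing, fun e he => ?_⟩
  obtain ⟨i, h1, h2, h3, h4, h5⟩ := (tadpoleEdge_of_mem hn hk e he).pathEdge
  rcases eq_or_lt_of_le h1 with rfl | hi
  · exact Or.inr h3
  left; right
  rcases hp i (by omega) h2 with ⟨h6, h7⟩ | ⟨h6, h7⟩
  · exact ⟨_, _, h7, h3, h4 (by omega)⟩
  · exact ⟨_, _, h7, h3, h5 h6⟩

theorem ceil_logb_two_le_iff {x : ℝ} (hx : 0 < x) (m : ℕ) :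
    ⌈Real.logb 2 x⌉₊ ≤ m ↔ x ≤ 2 ^ m := by
  rw [Nat.ceil_le, Real.logb_le_iff_le_rpow (by norm_num) hx, Real.rpow_natCast]

/-- This is where `σ` comes from: `2 * (n + k + σ(n))` is the integer `n + 2k + 2 ^ L + 2` of the
strategies. -/
theorem ceil_logb_two_add_tadpoleSigma_le_iff (hn : 3 ≤ n) (m : ℕ) :
    ⌈Real.logb 2 ((n : ℝ) + (k : ℝ) + tadpoleSigma n)⌉₊ ≤ m ↔
      (n : ℤ) + 2 * k + 2 ^ ⌈Real.logb 2 (n : ℝ)⌉₊ + 2 ≤ 2 * 2 ^ m := by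
  have hn0 : (3 : ℝ) ≤ n := by exact_mod_cast hn
  have hk0 : (0 : ℝ) ≤ k := Nat.cast_nonneg k
  rw [tadpoleSigma]
  set L := ⌈Real.logb 2 (n : ℝ)⌉₊
  have hL : (0 : ℝ) < 2 ^ L := by positivity
  rw [ceil_logb_two_le_iff (by linarith), ← Int.cast_le (R := ℝ)]
  push_cast
  constructor <;> intro h <;> linarith

end Tadpole

/-! ### The main theorem -/

theorem mainTheorem1 (n k : ℕ) (hn : 3 ≤ n) (hk : 1 ≤ k) :
    DominatorWinsDGame (tadpoleGraph n k hn hk) ∧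
    gammaSMB (tadpoleGraph n k hn hk) = ⊤ ∧
    (Even n ∧ Odd k →
      gammaSMB' (tadpoleGraph n k hn hk) =
        ((⌈Real.logb 2 ((n : ℝ) + (k : ℝ) + tadpoleSigma n)⌉₊ : ℕ) : ℕ∞)) ∧
    (¬ (Even n ∧ Odd k) → gammaSMB' (tadpoleGraph n k hn hk) = ⊤) := by
  obtain ⟨R, y, hR, hE⟩ := exists_tadpole_isPairing hn hk
  refine ⟨dominatorWinsDGame_of_isPairing _ hR y hE, gammaSMB_eq_top_of_isPairing _ hR y hE,
    ?_, ?_⟩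
  · rintro ⟨hn2, hk2⟩
    rw [Nat.even_iff] at hn2
    rw [Nat.odd_iff] at hk2
    have hn0 : (0 : ℝ) < n := by exact_mod_cast (by omega : 0 < n)
    have hL1 : (n : ℤ) ≤ 2 ^ ⌈Real.logb 2 (n : ℝ)⌉₊ := by
      exact_mod_cast (ceil_logb_two_le_iff hn0 _).1 le_rfl
    -- By minimality of the ceiling, `2 ^ (L - 1) < n`.
    have hL2 : (2 : ℤ) ^ ⌈Real.logb 2 (n : ℝ)⌉₊ < 2 * n := by
      have h := ceil_logb_two_le_iff hn0
      generalize ⌈Real.logb 2 (n : ℝ)⌉₊ = L at h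
      rcases L with _ | L
      · simp
        omega
      · have h1 : (2 : ℝ) ^ L < n := lt_of_not_ge fun h2 => absurd ((h L).2 h2) (by omega)
        have h2 : (2 : ℤ) ^ L < n := by exact_mod_cast h1
        rw [pow_succ]
        omega
    refine winningNumber_eq_coe (fun m hm => ?_) ?_
    · rw [ceil_logb_two_add_tadpoleSigma_le_iff hn]
      by_contra h
      exact (tadpole_strip hn hk).tadpole_not_winsWithin
        (fun e he => Or.inr (tadpoleEdge_of_mem hn hk e he)) (by omega) (by omega) (by omega)
        (by omega) hL2 (by omega) hm
    · have h := (ceil_logb_two_add_tadpoleSigma_le_iff (k := k) hn _).1 le_rfl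
      exact (tadpole_freeSeq hn hk).tadpole_winsWithin (hasTadpoleEdge_closedNbhd hn hk ∅)
        (by omega) (by omega) (by omega) (by omega) hL1 hL2 (by omega)
  · intro hnk
    refine winningNumber_eq_top fun m hm => ?_
    by_cases hpar : Even (n + k)
    · obtain ⟨R, hR, hE⟩ := exists_tadpole_isPairing_of_even hn hk hpar
      exact hR.not_winsWithin hE m hm
    -- What remains is odd `n` and even `k`.
    · rw [Nat.even_iff, Nat.odd_iff] at hnk
      rw [Nat.even_iff] at hpar
      exact (tadpole_strip hn hk).tadpole_not_winsWithin_of_odd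
        (fun e he => Or.inr (tadpoleEdge_of_mem hn hk e he)) (by omega) (by omega) (by omega)
        (by omega) hm
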